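/- **Cryptosystem.** For a security parameter $\kappa$, a key generation center draws distinct $\kappa$-bit primes $p,q$, with $(p-1)/2$ and $(q-1)/2$ odd and coprime, from an arbitrary distribution, and puts $N=pq$. It picks a random generator $g=-a^{2N}\in\mathbb{Z}_{N^2}$ of order $(p-1)(q-1)/2$, and for each participant $u_i$ ($1\le i\le n$, with $n$ fixed) a weak private key $sk_i$ uniform in $[1,N/4]$ with public key $h_i=g^{sk_i}$. With $\lambda=\mathrm{lcm}(p-1,q-1)$ it picks random residues $\lambda_1,\lambda_2$ modulo $\lambda N^2$ with $\lambda_1+\lambda_2\equiv 0 \pmod \lambda$ and $\lambda_1+\lambda_2\equiv 1\pmod{N^2}$; the share $\lambda_2$ is given to the computation service provider CC. A plaintext $m$ of $u_i$ is encrypted as $(C_1,C_2)=(h_i^{r}(1+mN),\,g^{r})\in\mathbb{Z}_{N^2}^2$ with $r$ uniform in $[1,N/4]$, and $\mathrm{HEncRef}(r,(C_1,C_2))=(C_1C_2^{\,r},\,C_2)$. **Protocol.** The center server CS holds a random forest; each inner node of each tree has a provider $u_i$ and a split encrypted under $h_i$. On a revocation request of a participant $u_r$ that CS accepts, CS traverses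 every tree from its root; each node of $u_r$ that is reached is destroyed together with all its descendants. In a second-level revocation CS sends to CC, for every such node, the request and the encrypted splits of all nodes destroyed there; for each received ciphertext $s_d$, CC draws $r_d$ uniformly from $\mathbb{Z}_N$ and returns $\mathrm{HEncRef}(r_d,s_d)$. In a first-level revocation, or if the request is rejected, CC receives nothing. No other step of the protocol involves CC. **Views.** A probabilistic polynomial time (PPT) environment, given the local data of CC ($1^\kappa$, $N$, $g$, all $h_i$, $\lambda_2$), chooses the plaintext forest, the revoked participant, the request, whether it is accepted, the level, and a state. The *real view* of the curious-but-honest corrupted CC consists of its local data, the received messages, its random values $r_d$ and its answers. In the *ideal view* the part after the local data is produced by a simulator $\xi_{CC}$, which gets only the local data of CC and, for each message, the request and the number of ciphertexts in it (it gets neither plaintexts, nor ciphertexts, nor the providers of the splits). A distinguisher is given the view together with the complete output of the environment (its state and all the inputs it chose). **Assumption (DDH over $\mathbb{Z}_{N^2}$).** With $N,g$ generated as above and $x,y$ uniform in $[1,N/4]$, the tuples $(1^\kappa,N,g,g^x,g^y,g^{xy})$ and $(1^\kappa,N,g,g^x,g^y,Z)$ are computationally indistinguishable, where $Z=\pm b^2$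 with a uniform sign and $b$ uniform in $\mathbb{Z}_{N^2}$ (up to the negligible case that $b$ is not invertible, $Z$ is a uniform element of the subgroup $\langle g,1+N\rangle$ of $\mathbb{Z}_{N^2}^*$). **Theorem.** Under the DDH assumption over $\mathbb{Z}_{N^2}$, there is a PPT simulator $\xi_{CC}$ for the participant revocation protocol such that, for every PPT environment, the ideal view produced by $\xi_{CC}$ is computationally indistinguishable from the real view of the corrupted CC: every PPT distinguisher has negligible advantage in $\kappa$. -/

import Mathlib

noncomputable section

namespace RevFRF

/-! ### Finite probability -/

/-- The uniform distribution on a finite set of natural numbers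
(the point mass at `0` if the set is empty). -/
def unif (s : Finset ℕ) : PMF ℕ :=
  open Classical in
  if h : s.Nonempty then PMF.uniformOfFinset s h else PMF.pure 0

/-- `n` independent samples of `μ`. -/
def iid {α : Type} (μ : PMF α) : (n : ℕ) → PMF (Fin n → α)
  | 0 => PMF.pure Fin.elim0
  | n + 1 => μ.bind fun a => (iid μ n).bind fun f => PMF.pure (Fin.cons a f)

/-- Apply a randomized map to the entries of a list, with independent randomness. -/
def sampleList {α β : Type} (f : α → PMF β) : List α → PMF (List β)
  | [] => PMF.pure []
  | a :: l => (f a).bind fun b => (sampleList f l).bind fun bs => PMF.pure (b :: bs)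

/-! ### Probabilistic programs with a step count

Data are binary trees whose leaves carry natural numbers written in binary. Programs form a small
first-order language: arithmetic and pairing, uniform sampling, sequencing, branching, `for` loops
and structural recursion. Every step is charged the bit size of what it reads and writes, so that
running time bounds the space used and is polynomially related to Turing machine time. -/

inductive Data : Type
  | num (n : ℕ) : Data
  | pair (a b : Data) : Data

namespace Data

/-- Bit size. -/
def size : Data → ℕ
  | num n => Nat.size n + 1
  | pair a b => a.size + b.size + 1

def fst : Data → Data
  | num _ => num 0
  | pair a _ => a

def snd : Data → Data
  | num _ => num 0
  | pair _ b => b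

def val : Data → ℕ
  | num n => n
  | pair _ _ => 0

def ofList : List Data → Data
  | [] => num 0
  | a :: l => pair a (ofList l)

def toList : Data → List Data
  | num _ => []
  | pair a b => a :: b.toList

/-- The number `k` written in unary. -/
def unary (k : ℕ) : Data := ofList (List.replicate k (num 0))

end Data

/-- Deterministic one-step operations. The arithmetic ones act on a pair of numbers. -/
inductive Op : Type
  | id | const (d : Data) | fst | snd | isPair | size | add | sub | mul | div | mod | le

def Op.eval : Op → Data → Data
  | .id, x => x
  | .const d, _ => d
  | .fst, x => x.fst
  | .snd, x => x.snd
  | .isPair, .pair _ _ => .num 1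
  | .isPair, .num _ => .num 0
  | .size, x => .num x.size
  | .add, x => .num (x.fst.val + x.snd.val)
  | .sub, x => .num (x.fst.val - x.snd.val)
  | .mul, x => .num (x.fst.val * x.snd.val)
  | .div, x => .num (x.fst.val / x.snd.val)
  | .mod, x => .num (x.fst.val % x.snd.val)
  | .le, x => .num (if x.fst.val ≤ x.snd.val then 1 else 0)

inductive Prog : Type
  /-- a deterministic operation -/
  | op (o : Op) : Prog
  /-- on input `k`, a uniform number below `k` -/
  | rand : Prog
  /-- run `f` and `g` on the same input and pair the results -/
  | pair (f g : Prog) : Prog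
  /-- run `f`, then `g` on its result -/
  | seq (f g : Prog) : Prog
  /-- if `c` returns a nonzero number run `f`, otherwise `g`, on the same input -/
  | ite (c f g : Prog) : Prog
  /-- on input `(k, s)`, run `f` repeatedly `k` times, starting from `s` -/
  | loop (f : Prog) : Prog
  /-- on input `(t, c)`, structural recursion over the tree `t` with parameter `c`:
  `f` treats the leaves and `g` combines the results for the two subtrees -/
  | recur (f g : Prog) : Prog

/-- Iterate a randomized step with a cost, accumulating the cost. -/
def iterCost (F : Data → PMF (Data × ℕ)) : ℕ → Data → PMF (Data × ℕ)
  | 0, s => PMF.pure (s, 0)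
  | k + 1, s => (F s).bind fun a => (iterCost F k a.1).bind fun b => PMF.pure (b.1, a.2 + b.2)

/-- Structural recursion with a cost, accumulating the cost. -/
def recurCost (F G : Data → PMF (Data × ℕ)) (c : Data) : Data → PMF (Data × ℕ)
  | .num k => F (.pair (.num k) c)
  | .pair a b =>
      (recurCost F G c a).bind fun ra =>
      (recurCost F G c b).bind fun rb =>
      (G (.pair (.pair a b) (.pair (.pair ra.1 rb.1) c))).bind fun o =>
      PMF.pure (o.1, ra.2 + rb.2 + o.2)

/-- The joint distribution of the result and the number of steps of a program on an input. -/
def Prog.run : Prog → Data → PMF (Data × ℕ)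
  | .op o, x => PMF.pure (o.eval x, 1 + x.size + (o.eval x).size)
  | .rand, x => (unif (Finset.range x.val)).bind fun r =>
      PMF.pure (.num r, 1 + x.size + (Data.num r).size)
  | .pair f g, x => (f.run x).bind fun a => (g.run x).bind fun b =>
      PMF.pure (.pair a.1 b.1, 1 + x.size + (Data.pair a.1 b.1).size + a.2 + b.2)
  | .seq f g, x => (f.run x).bind fun a => (g.run a.1).bind fun b =>
      PMF.pure (b.1, 1 + a.2 + b.2)
  | .ite c f g, x => (c.run x).bind fun a =>
      (if a.1.val ≠ 0 then f.run x else g.run x).bind fun b => PMF.pure (b.1, 1 + a.2 + b.2)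
  | .loop f, x => (iterCost f.run x.fst.val x.snd).bind fun b =>
      PMF.pure (b.1, 1 + x.size + b.2)
  | .recur f g, x => (recurCost f.run g.run x.snd x.fst).bind fun b =>
      PMF.pure (b.1, 1 + x.size + b.2)

/-- The output distribution. -/
def Prog.out (P : Prog) (x : Data) : PMF Data := (P.run x).map Prod.fst

/-- Probabilistic polynomial time: for every input and all random choices, the number of steps is
at most a fixed polynomial in the size of the input. -/
def Prog.PPT (P : Prog) : Prop :=
  ∃ b : Polynomial ℕ, ∀ x : Data, ∀ o ∈ (P.run x).support, o.2 ≤ b.eval x.size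

/-! ### Computational indistinguishability -/

def Negligible (f : ℕ → ℝ) : Prop :=
  Asymptotics.SuperpolynomialDecay Filter.atTop (fun k : ℕ => (k : ℝ)) f

/-- The probability that `D` answers `1` on a sample of `μ`. -/
def accepts (D : Prog) (μ : PMF Data) : ℝ := ((μ.bind D.out) (Data.num 1)).toReal

/-- No probabilistic polynomial time program tells the two ensembles apart. -/
def CompIndist (X Y : ℕ → PMF Data) : Prop :=
  ∀ D : Prog, D.PPT → Negligible fun k => |accepts D (X k) - accepts D (Y k)|

/-! ### The cryptosystem -/

/-- Admissible prime pairs for security parameter `k`: distinct `k`-bit primes `p`, `q` such that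
`(p - 1) / 2` and `(q - 1) / 2` are odd and coprime (for instance safe primes). The last conditions
are exactly what is needed for `- a ^ (2 N)` to have order `(p - 1) (q - 1) / 2` for some `a`. -/
structure ValidPrimes (k p q : ℕ) : Prop where
  prime_p : p.Prime
  prime_q : q.Prime
  ne : p ≠ q
  size_p : Nat.size p = k
  size_q : Nat.size q = k
  odd_p : Odd ((p - 1) / 2)
  odd_q : Odd ((q - 1) / 2)
  coprime : Nat.Coprime ((p - 1) / 2) ((q - 1) / 2)

/-- A family of distributions of prime pairs, admissible for all large security parameters. -/
def ValidGen (gen : ℕ → PMF (ℕ × ℕ)) : Prop :=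
  ∀ᶠ k in Filter.atTop, ∀ pq ∈ (gen k).support, ValidPrimes k pq.1 pq.2

/-- The ambient ring `ℤ / N²`. -/
abbrev Z2 (N : ℕ) : Type := ZMod (N ^ 2)

/-- The random generator `g = - a ^ (2 N)`, of order `(p - 1) (q - 1) / 2`, for `N = p q`. -/
def sampleG (p q : ℕ) : PMF (Z2 (p * q)) :=
  open Classical in
  (unif ((Finset.range ((p * q) ^ 2)).filter fun a : ℕ =>
    orderOf (-(a : Z2 (p * q)) ^ (2 * (p * q))) = (p - 1) * (q - 1) / 2)).map
      fun a : ℕ => -(a : Z2 (p * q)) ^ (2 * (p * q))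

/-- Weak private keys and encryption randomness: a uniform element of `[1, N / 4]`. -/
def sampleExp (N : ℕ) : PMF ℕ := unif (Finset.Icc 1 (N / 4))

/-- Shares `(l₁, l₂)` of the strong private key `l = lcm (p - 1, q - 1)`: a random pair of residues
modulo `l N²` subject to `l₁ + l₂ ≡ 0 mod l` and `l₁ + l₂ ≡ 1 mod N²`. -/
def sampleShares (p q : ℕ) : PMF (ℕ × ℕ) :=
  let l := Nat.lcm (p - 1) (q - 1)
  let M := l * (p * q) ^ 2
  (unif (Finset.range M)).map fun l2 =>
    ((l * ((l : Z2 (p * q))⁻¹).val + (M - l2)) % M, l2)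

abbrev Ciphertext (N : ℕ) : Type := Z2 N × Z2 N

/-- Encryption of `m` under the public key `(N, g, h)`. -/
def HoEnc {N : ℕ} (g h : Z2 N) (m : ℕ) : PMF (Ciphertext N) :=
  (sampleExp N).map fun r => (h ^ r * (1 + (m : Z2 N) * (N : Z2 N)), g ^ r)

/-- Ciphertext refresh. -/
def HEncRef {N : ℕ} (r : ℕ) (c : Ciphertext N) : Ciphertext N := (c.1 * c.2 ^ r, c.2)

/-! ### The decisional Diffie-Hellman assumption over `ℤ / N²` -/

/-- A random element `± b²` with `b` uniform in `ℤ / N²`. These elements (when invertible) form the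
group generated by `g` and `1 + N`, the subgroup of `(ℤ / N²)ˣ` in which ciphertexts lie. -/
def sampleElt (N : ℕ) : PMF (Z2 N) :=
  (unif (Finset.range 2)).bind fun s => (unif (Finset.range (N ^ 2))).map fun b : ℕ =>
    (-1) ^ s * (b : Z2 N) ^ 2

def ddhData (k N : ℕ) (g X Y Z : Z2 N) : Data :=
  .ofList [.unary k, .num N, .num g.val, .num X.val, .num Y.val, .num Z.val]

/-- The ensemble `(g, g ^ x, g ^ y, g ^ (x y))`. -/
def ddhReal (gen : ℕ → PMF (ℕ × ℕ)) (k : ℕ) : PMF Data :=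
  (gen k).bind fun pq =>
  (sampleG pq.1 pq.2).bind fun g =>
  (sampleExp (pq.1 * pq.2)).bind fun x =>
  (sampleExp (pq.1 * pq.2)).bind fun y =>
  PMF.pure (ddhData k (pq.1 * pq.2) g (g ^ x) (g ^ y) (g ^ (x * y)))

/-- The ensemble `(g, g ^ x, g ^ y, Z)` with `Z` random. -/
def ddhRandom (gen : ℕ → PMF (ℕ × ℕ)) (k : ℕ) : PMF Data :=
  (gen k).bind fun pq =>
  (sampleG pq.1 pq.2).bind fun g =>
  (sampleExp (pq.1 * pq.2)).bind fun x =>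
  (sampleExp (pq.1 * pq.2)).bind fun y =>
  (sampleElt (pq.1 * pq.2)).bind fun Z =>
  PMF.pure (ddhData k (pq.1 * pq.2) g (g ^ x) (g ^ y) Z)

def DDH (gen : ℕ → PMF (ℕ × ℕ)) : Prop := CompIndist (ddhReal gen) (ddhRandom gen)

/-! ### Random forests and the revocation protocol -/

/-- Random decision trees over `n` participants: every inner node carries its provider and its
split (in plain or encrypted form). -/
inductive Tree (n : ℕ) (σ : Type) : Type
  | leaf : Tree n σ
  | node (provider : Fin n) (split : σ) (left right : Tree n σ) : Tree n σ

namespace Tree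

variable {n : ℕ} {σ : Type}

/-- All splits of a tree. -/
def splits : Tree n σ → List σ
  | leaf => []
  | node _ s l r => s :: (l.splits ++ r.splits)

/-- Traversal of a tree from the root: whenever a node provided by participant `u` is reached, it is
destroyed together with all nodes below it. One list of destroyed splits per such node. -/
def destroyed (u : ℕ) : Tree n σ → List (List σ)
  | leaf => []
  | node v s l r =>
      if (v : ℕ) = u then [splits (node v s l r)] else l.destroyed u ++ r.destroyed u

/-- Every provider encrypts its splits under its own public key. -/
def encrypt {N : ℕ} (g : Z2 N) (h : Fin n → Z2 N) : Tree n ℕ → PMF (Tree n (Ciphertext N))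
  | leaf => PMF.pure leaf
  | node u m l r =>
      (HoEnc g (h u) m).bind fun c => (l.encrypt g h).bind fun l' =>
      (r.encrypt g h).bind fun r' => PMF.pure (node u c l' r')

/-- Reading a tree from data; ill-formed nodes and unknown providers are read as leaves. -/
def ofData (n : ℕ) : Data → Tree n ℕ
  | .pair (.pair (.num u) (.num m)) (.pair l r) =>
      if hu : u < n then node ⟨u, hu⟩ m (ofData n l) (ofData n r) else leaf
  | _ => leaf

end Tree

/-- What is fixed by the environment before a run of the revocation protocol. -/
structure RevocInput (n : ℕ) where
  /-- whether the center server finds the signature of the request valid -/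
  accepted : Bool
  /-- second-level (`true`) or first-level (`false`) revocation -/
  secondLevel : Bool
  /-- the index of the revoked participant -/
  revoked : ℕ
  /-- the revocation request -/
  request : Data
  /-- the trained forest, with its splits in plain -/
  forest : List (Tree n ℕ)

/-- Reading an input from data of the form `(accepted, level, revoked, request, forest)`. -/
def RevocInput.ofData (n : ℕ) (d : Data) : RevocInput n where
  accepted := d.fst.val == 1
  secondLevel := d.snd.fst.val == 1
  revoked := d.snd.snd.fst.val
  request := d.snd.snd.snd.fst
  forest := d.snd.snd.snd.snd.toList.map (Tree.ofData n)

/-- A message of the center server to the computation service provider. -/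
structure Message (σ : Type) where
  request : Data
  splits : List σ

/-- The messages that the center server sends to the computation service provider when it runs the
protocol on the forest `T`: none if the request is rejected or the revocation is of the first level;
otherwise, for every node of the revoked participant that is reached in the traversal, the request
and the splits of all nodes destroyed there. The remaining steps of the protocol (rebuilding the
destroyed nodes, the second refresh, key revocation, publication) do not involve the computation
service provider. -/
def csMessages {n : ℕ} {σ : Type} (inp : RevocInput n) (T : List (Tree n σ)) :
    List (Message σ) :=
  if inp.accepted && inp.secondLevel then
    (T.flatMap (Tree.destroyed inp.revoked)).map fun s => ⟨inp.request, s⟩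
  else []

/-- What the computation service provider sees while it handles one message. -/
structure Round (N : ℕ) where
  /-- the received message -/
  received : Message (Ciphertext N)
  /-- its random choices, one for each destroyed node -/
  coins : List ℕ
  /-- its answer -/
  sent : List (Ciphertext N)

/-- The computation service provider: refresh every received ciphertext with a fresh random value
of `ℤ / N`. -/
def ccRound {N : ℕ} (m : Message (Ciphertext N)) : PMF (Round N) :=
  (sampleList (fun _ => unif (Finset.range N)) m.splits).map fun rs =>
    ⟨m, rs, List.zipWith HEncRef rs m.splits⟩

/-! ### Real and ideal views -/

def Ciphertext.toData {N : ℕ} (c : Ciphertext N) : Data := .pair (.num c.1.val) (.num c.2.val)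

def Round.toData {N : ℕ} (v : Round N) : Data :=
  .ofList [v.received.request, .ofList (v.received.splits.map Ciphertext.toData),
    .ofList (v.coins.map Data.num), .ofList (v.sent.map Ciphertext.toData)]

/-- The local data of the computation service provider: the security parameter, the public keys of
all participants and its share of the strong private key. -/
def ccLocal {n : ℕ} (k N : ℕ) (g : Z2 N) (h : Fin n → Z2 N) (l2 : ℕ) : Data :=
  .ofList [.unary k, .num N, .num g.val, .ofList (List.ofFn fun i => .num (h i).val), .num l2]

/-- What the simulator learns about a run: for every message, the request and the number of
ciphertexts in it (in unary). -/
def leakage {n : ℕ} (inp : RevocInput n) : Data :=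
  .ofList ((csMessages inp inp.forest).map fun m => .pair m.request (.unary m.splits.length))

/-- The distribution of the interaction of the environment `env` with a corrupted computation
service provider: the key generation center issues the keys, the environment sees the local data of
the provider and returns `(state, input)`, the protocol is run on this input, and `view` supplies
what the provider sees during the run. -/
def experiment (n : ℕ) (gen : ℕ → PMF (ℕ × ℕ)) (env : Prog)
    (view : {N : ℕ} → (g : Z2 N) → (h : Fin n → Z2 N) → (loc : Data) → RevocInput n → PMF Data)
    (k : ℕ) : PMF Data :=
  (gen k).bind fun pq =>
  (sampleG pq.1 pq.2).bind fun g =>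
  (iid (sampleExp (pq.1 * pq.2)) n).bind fun sk =>
  (sampleShares pq.1 pq.2).bind fun l =>
  let h : Fin n → Z2 (pq.1 * pq.2) := fun i => g ^ sk i
  let loc := ccLocal k (pq.1 * pq.2) g h l.2
  (env.out loc).bind fun e =>
  (view g h loc (RevocInput.ofData n e.snd)).bind fun t =>
  PMF.pure (.pair loc (.pair e t))

/-- The real view: the forest is encrypted by the providers of its splits, and the protocol is run
between the center server and the computation service provider. -/
def realView (n : ℕ) (gen : ℕ → PMF (ℕ × ℕ)) (env : Prog) : ℕ → PMF Data :=
  experiment n gen env fun g h _ inp =>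
    (sampleList (Tree.encrypt g h) inp.forest).bind fun T =>
    (sampleList ccRound (csMessages inp T)).map fun rounds =>
    .ofList (rounds.map Round.toData)

/-- The ideal view: everything that the provider sees during the run is made up by the simulator
`sim` from the local data of the provider and the leakage. -/
def idealView (n : ℕ) (gen : ℕ → PMF (ℕ × ℕ)) (env sim : Prog) : ℕ → PMF Data :=
  experiment n gen env fun _ _ loc inp => sim.out (.pair loc (leakage inp))

end RevFRF

end

noncomputable section

namespace RevFRF

/-! ### Running time and size -/

/-! A ciphertext of `m` under `h = g ^ x` with randomness `y` is `(g ^ (x y) (1 + m N), g ^ y)`.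
Under DDH the factor `g ^ (x y)` may be replaced by `Z = ± b ^ 2`. Since `N` is odd, `1 + m N` is
the square of the unit `u = 1 + (m / 2) N`, so `Z (1 + m N) = ± (b u) ^ 2`. This has exactly the
distribution of `Z`, because multiplication by `u` permutes `ℤ / N²` (`sampleElt_bind_mul`). The
resulting pair `(Z, g ^ y)` depends neither on the plaintext nor on the provider. The simulator
therefore draws such a pair for every ciphertext announced by the leakage and refreshes it honestly;
the coins and answers of the provider are computed from the pair and `N` alone.

The passage from the real to the ideal view is a hybrid argument with two indices. In `hybrid i j`
the splits of participants before `i` are simulated, and so are those of `i` with position less than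
`j`. The position of a split is the size of the data behind it, so distinct splits have distinct
positions and a polynomial `Q` bounds them all. The reduction for `i` installs the challenge `g ^ x`
as the key of `i`, guesses `j` below `Q`, and builds the ciphertext of `i` at position `j`, if there
is one, from the challenge. A real challenge yields `hybrid i j`, a random one `hybrid i (j + 1)`
(`bind_reduction`). Averaging over `j` telescopes, so each participant costs `Q` times a DDH
advantage (`hybrid_sub_eq`), and `hybrid i Q = hybrid (i + 1) 0` links the participants. Their
number `n` is fixed, so the total stays negligible.

The reduction must also hand the environment a share `λ₂`, uniform below `λ N²`, without knowing
`λ`. It draws below `⌊N / 2⌋ N²` instead, at a statistical cost of at most `8 / 2 ^ k`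
(`abs_accepts_sampleShares_sub_le`).

Simulator and reductions must be polynomial time programs of the given language. This rests on
closure properties of `Feasible`; recursion and iteration additionally need size bounds on
intermediate values, without which repeated steps could grow them exponentially. -/

theorem Data.one_le_size : ∀ d : Data, 1 ≤ d.size
  | .num _ => by simp [Data.size]
  | .pair _ _ => by simp [Data.size]

theorem Data.fst_size_le (x : Data) : x.fst.size ≤ x.size := by
  cases x <;> simp [Data.fst, Data.size]
  omega

theorem Data.snd_size_le (x : Data) : x.snd.size ≤ x.size := by
  cases x <;> simp [Data.snd, Data.size]
  omega

theorem iterCost_size {F : Data → PMF (Data × ℕ)}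
    (hF : ∀ x, ∀ o ∈ (F x).support, o.1.size ≤ o.2) :
    ∀ (k : ℕ) (s : Data), ∀ o ∈ (iterCost F k s).support, o.1.size ≤ s.size + o.2
  | 0, s, o, ho => by
      simp only [iterCost, PMF.mem_support_pure_iff] at ho
      simp [ho]
  | k + 1, s, o, ho => by
      simp only [iterCost, PMF.mem_support_bind_iff, PMF.mem_support_pure_iff] at ho
      obtain ⟨a, ha, b, hb, rfl⟩ := ho
      have h1 := hF _ _ ha
      have h2 := iterCost_size hF k _ _ hb
      simp only
      omega

theorem recurCost_size {F G : Data → PMF (Data × ℕ)}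
    (hF : ∀ x, ∀ o ∈ (F x).support, o.1.size ≤ o.2)
    (hG : ∀ x, ∀ o ∈ (G x).support, o.1.size ≤ o.2) (c : Data) :
    ∀ t : Data, ∀ o ∈ (recurCost F G c t).support, o.1.size ≤ o.2
  | .num k, o, ho => hF _ _ ho
  | .pair a b, o, ho => by
      simp only [recurCost, PMF.mem_support_bind_iff, PMF.mem_support_pure_iff] at ho
      obtain ⟨ra, -, rb, -, q, hq, rfl⟩ := ho
      have := hG _ _ hq
      simp only
      omega

/-- The output of a program is no larger than its running time. -/
theorem Prog.size_le_cost : ∀ (P : Prog) (x : Data), ∀ o ∈ (P.run x).support, o.1.size ≤ o.2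
  | .op o, x, r, hr => by
      simp only [Prog.run, PMF.mem_support_pure_iff] at hr
      simp only [hr]; omega
  | .rand, x, r, hr => by
      simp only [Prog.run, PMF.mem_support_bind_iff, PMF.mem_support_pure_iff] at hr
      obtain ⟨a, -, rfl⟩ := hr
      simp only; omega
  | .pair f g, x, r, hr => by
      simp only [Prog.run, PMF.mem_support_bind_iff, PMF.mem_support_pure_iff] at hr
      obtain ⟨a, -, b, -, rfl⟩ := hr
      simp only; omega
  | .seq f g, x, r, hr => by
      simp only [Prog.run, PMF.mem_support_bind_iff, PMF.mem_support_pure_iff] at hr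
      obtain ⟨a, -, b, hb, rfl⟩ := hr
      have := Prog.size_le_cost g _ _ hb
      simp only; omega
  | .ite c f g, x, r, hr => by
      simp only [Prog.run, PMF.mem_support_bind_iff, PMF.mem_support_pure_iff] at hr
      obtain ⟨a, -, b, hb, rfl⟩ := hr
      have : b.1.size ≤ b.2 := by
        split_ifs at hb
        · exact Prog.size_le_cost f _ _ hb
        · exact Prog.size_le_cost g _ _ hb
      simp only; omega
  | .loop f, x, r, hr => by
      simp only [Prog.run, PMF.mem_support_bind_iff, PMF.mem_support_pure_iff] at hr
      obtain ⟨b, hb, rfl⟩ := hr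
      have := iterCost_size (Prog.size_le_cost f) _ _ _ hb
      have h2 : x.snd.size ≤ x.size := x.snd_size_le
      simp only; omega
  | .recur f g, x, r, hr => by
      simp only [Prog.run, PMF.mem_support_bind_iff, PMF.mem_support_pure_iff] at hr
      obtain ⟨b, hb, rfl⟩ := hr
      have := recurCost_size (Prog.size_le_cost f) (Prog.size_le_cost g) _ _ _ hb
      simp only; omega

/-! ### Size growth of the basic operations -/

theorem Data.num_size_mono {a b : ℕ} (h : a ≤ b) : (Data.num a).size ≤ (Data.num b).size := by
  simp only [Data.size]
  have := Nat.size_le_size h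
  omega

theorem Data.num_val_size_le (x : Data) : (Data.num x.val).size ≤ x.size := by
  cases x <;> simp [Data.val, Data.size]

theorem Data.num_add_size_le (a b : ℕ) :
    (Data.num (a + b)).size ≤ (Data.num a).size + (Data.num b).size := by
  simp only [Data.size]
  have : Nat.size (a + b) ≤ Nat.size a + Nat.size b + 1 := by
    rw [Nat.size_le]
    have h1 := Nat.lt_size_self a
    have h2 := Nat.lt_size_self b
    have h3 : 2 ^ a.size ≤ 2 ^ (a.size + b.size) := Nat.pow_le_pow_right (by norm_num) (by omega)
    have h4 : 2 ^ b.size ≤ 2 ^ (a.size + b.size) := Nat.pow_le_pow_right (by norm_num) (by omega)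
    rw [pow_succ]
    omega
  omega

theorem Data.num_mul_size_le (a b : ℕ) :
    (Data.num (a * b)).size ≤ (Data.num a).size + (Data.num b).size := by
  simp only [Data.size]
  have : Nat.size (a * b) ≤ Nat.size a + Nat.size b := by
    rw [Nat.size_le, pow_add]
    exact Nat.mul_lt_mul'' (Nat.lt_size_self a) (Nat.lt_size_self b)
  omega

theorem Data.num_size_le_self (a : ℕ) : (Data.num a).size ≤ a + 1 := by
  simp only [Data.size]
  have : Nat.size a ≤ a := by
    rw [Nat.size_le]
    exact Nat.lt_two_pow_self
  omega

theorem Op.size_eval_le (o : Op) : ∃ c : ℕ, ∀ x : Data, (o.eval x).size ≤ 2 * x.size + c := by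
  cases o with
  | id => exact ⟨0, fun x => by simp only [Op.eval]; omega⟩
  | const d => exact ⟨d.size, fun x => by simp only [Op.eval]; omega⟩
  | fst => exact ⟨0, fun x => by have := x.fst_size_le; simp only [Op.eval]; omega⟩
  | snd => exact ⟨0, fun x => by have := x.snd_size_le; simp only [Op.eval]; omega⟩
  | isPair => exact ⟨2, fun x => by cases x <;> simp [Op.eval, Data.size]⟩
  | size => exact ⟨1, fun x => by have := Data.num_size_le_self x.size; simp only [Op.eval]; omega⟩
  | add =>
      refine ⟨0, fun x => ?_⟩
      have h1 := Data.num_add_size_le x.fst.val x.snd.val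
      have h2 := Data.num_val_size_le x.fst
      have h3 := Data.num_val_size_le x.snd
      have h4 := x.fst_size_le
      have h5 := x.snd_size_le
      simp only [Op.eval]; omega
  | sub =>
      refine ⟨0, fun x => ?_⟩
      have h1 := Data.num_size_mono (Nat.sub_le x.fst.val x.snd.val)
      have h2 := Data.num_val_size_le x.fst
      have h4 := x.fst_size_le
      simp only [Op.eval]; omega
  | mul =>
      refine ⟨0, fun x => ?_⟩
      have h1 := Data.num_mul_size_le x.fst.val x.snd.val
      have h2 := Data.num_val_size_le x.fst
      have h3 := Data.num_val_size_le x.snd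
      have h4 := x.fst_size_le
      have h5 := x.snd_size_le
      simp only [Op.eval]; omega
  | div =>
      refine ⟨0, fun x => ?_⟩
      have h1 := Data.num_size_mono (Nat.div_le_self x.fst.val x.snd.val)
      have h2 := Data.num_val_size_le x.fst
      have h4 := x.fst_size_le
      simp only [Op.eval]; omega
  | mod =>
      refine ⟨0, fun x => ?_⟩
      have h1 := Data.num_size_mono (Nat.mod_le x.fst.val x.snd.val)
      have h2 := Data.num_val_size_le x.fst
      have h4 := x.fst_size_le
      simp only [Op.eval]; omega
  | le =>
      refine ⟨2, fun x => ?_⟩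
      simp only [Op.eval]
      split_ifs <;> simp [Data.size]

/-- Coefficients in `ℕ` cannot cancel. Monotonicity is what allows a size bound to be substituted
into a time bound. -/
theorem natPoly_mono (b : Polynomial ℕ) : Monotone fun x => b.eval x := by
  intro x y h
  simp only [Polynomial.eval_eq_sum, Polynomial.sum]
  gcongr

/-! ### Output distributions of programs -/

theorem Prog.out_op (o : Op) (x : Data) : (Prog.op o).out x = PMF.pure (o.eval x) := by
  simp [Prog.out, Prog.run, PMF.pure_map]

theorem Prog.out_rand (x : Data) :
    Prog.rand.out x = (unif (Finset.range x.val)).bind fun r => PMF.pure (.num r) := by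
  simp [Prog.out, Prog.run, PMF.map_bind, PMF.pure_map]

theorem Prog.out_pair (f g : Prog) (x : Data) :
    (Prog.pair f g).out x =
      (f.out x).bind fun a => (g.out x).bind fun b => PMF.pure (.pair a b) := by
  simp [Prog.out, Prog.run, PMF.map_bind, PMF.bind_map, PMF.pure_map, Function.comp_def]

theorem Prog.out_seq (f g : Prog) (x : Data) :
    (Prog.seq f g).out x = (f.out x).bind g.out := by
  simp only [Prog.out, Prog.run, PMF.map_bind, PMF.bind_map, PMF.pure_map, Function.comp_def]
  rfl

theorem Prog.out_ite (c f g : Prog) (x : Data) :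
    (Prog.ite c f g).out x =
      (c.out x).bind fun a => if a.val ≠ 0 then f.out x else g.out x := by
  simp only [Prog.out, Prog.run, PMF.map_bind, PMF.bind_map, PMF.pure_map, Function.comp_def]
  congr 1; funext a
  split_ifs <;> rfl

/-- The output distribution of an iteration. -/
def iterOut (F : Data → PMF Data) : ℕ → Data → PMF Data
  | 0, s => PMF.pure s
  | k + 1, s => (F s).bind (iterOut F k)

theorem iterCost_map_fst (F : Data → PMF (Data × ℕ)) : ∀ (k : ℕ) (s : Data),
    (iterCost F k s).map Prod.fst = iterOut (fun x => (F x).map Prod.fst) k s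
  | 0, s => by simp [iterCost, iterOut, PMF.pure_map]
  | k + 1, s => by
      simp only [iterCost, iterOut, PMF.map_bind, PMF.bind_map, PMF.pure_map, Function.comp_def]
      congr 1; funext a
      rw [← iterCost_map_fst F k a.1]
      rfl

theorem Prog.out_loop (f : Prog) (x : Data) :
    (Prog.loop f).out x = iterOut f.out x.fst.val x.snd := by
  have h := iterCost_map_fst f.run x.fst.val x.snd
  simp only [Prog.out, Prog.run, PMF.map_bind, PMF.pure_map]
  exact h

/-- The output distribution of a structural recursion. -/
def recurOut (F G : Data → PMF Data) (c : Data) : Data → PMF Data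
  | .num k => F (.pair (.num k) c)
  | .pair a b =>
      (recurOut F G c a).bind fun ra =>
      (recurOut F G c b).bind fun rb => G (.pair (.pair a b) (.pair (.pair ra rb) c))

theorem recurCost_map_fst (F G : Data → PMF (Data × ℕ)) (c : Data) : ∀ t : Data,
    (recurCost F G c t).map Prod.fst =
      recurOut (fun x => (F x).map Prod.fst) (fun x => (G x).map Prod.fst) c t
  | .num k => by simp [recurCost, recurOut]
  | .pair a b => by
      simp only [recurCost, recurOut, PMF.map_bind, PMF.pure_map,
        ← recurCost_map_fst F G c a, ← recurCost_map_fst F G c b, PMF.bind_map,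
        Function.comp_def]
      rfl

theorem Prog.out_recur (f g : Prog) (x : Data) :
    (Prog.recur f g).out x = recurOut f.out g.out x.snd x.fst := by
  have h := recurCost_map_fst f.run g.run x.snd x.fst
  simp only [Prog.out, Prog.run, PMF.map_bind, PMF.pure_map]
  exact h

theorem Prog.fst_mem_support_out {P : Prog} {x : Data} {o : Data × ℕ}
    (h : o ∈ (P.run x).support) : o.1 ∈ (P.out x).support := by
  rw [Prog.out, PMF.mem_support_map_iff]
  exact ⟨o, h, rfl⟩

/-! ### Feasible kernels -/

/-- Randomized maps computed by a probabilistic polynomial time program. -/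
def Feasible (F : Data → PMF Data) : Prop := ∃ P : Prog, P.PPT ∧ ∀ x, P.out x = F x

/-- Maps computed by a polynomial time program. -/
def FeasibleFun (f : Data → Data) : Prop := Feasible fun x => PMF.pure (f x)

theorem Prog.PPT.feasible {P : Prog} (h : P.PPT) : Feasible P.out := ⟨P, h, fun _ => rfl⟩

/-- Writing is charged, so the time bound is also a size bound. -/
theorem Feasible.exists_size_le {F : Data → PMF Data} (h : Feasible F) :
    ∃ b : Polynomial ℕ, ∀ x, ∀ o ∈ (F x).support, o.size ≤ b.eval x.size := by
  obtain ⟨P, ⟨b, hb⟩, hP⟩ := h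
  refine ⟨b, fun x o ho => ?_⟩
  rw [← hP, Prog.out, PMF.mem_support_map_iff] at ho
  obtain ⟨r, hr, rfl⟩ := ho
  exact (P.size_le_cost x r hr).trans (hb x r hr)

theorem FeasibleFun.exists_size_le {f : Data → Data} (h : FeasibleFun f) :
    ∃ b : Polynomial ℕ, ∀ x, (f x).size ≤ b.eval x.size := by
  obtain ⟨b, hb⟩ := Feasible.exists_size_le h
  exact ⟨b, fun x => hb x _ (by simp)⟩

theorem Op.feasibleFun (o : Op) : FeasibleFun o.eval := by
  obtain ⟨c, hc⟩ := o.size_eval_le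
  refine ⟨.op o, ⟨3 * Polynomial.X + Polynomial.C (c + 1), fun x r hr => ?_⟩,
    fun x => Prog.out_op o x⟩
  simp only [Prog.run, PMF.mem_support_pure_iff] at hr
  have := hc x
  simp only [hr, Polynomial.eval_add, Polynomial.eval_mul, Polynomial.eval_ofNat,
    Polynomial.eval_X, Polynomial.eval_C]
  omega

/-- The second program runs on an input no larger than the running time of the first, hence the
summand `q.comp p`. -/
theorem Feasible.comp {F G : Data → PMF Data} (hF : Feasible F) (hG : Feasible G) :
    Feasible fun x => (F x).bind G := by
  obtain ⟨f, ⟨p, hp⟩, hf⟩ := hF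
  obtain ⟨g, ⟨q, hq⟩, hg⟩ := hG
  refine ⟨.seq f g, ⟨1 + p + q.comp p, fun x o ho => ?_⟩, fun x => ?_⟩
  · simp only [Prog.run, PMF.mem_support_bind_iff, PMF.mem_support_pure_iff] at ho
    obtain ⟨a, ha, b, hb, rfl⟩ := ho
    have h1 := hp x a ha
    have h2 := hq _ b hb
    have h3 := natPoly_mono q ((f.size_le_cost x a ha).trans h1)
    simp only [Polynomial.eval_add, Polynomial.eval_one, Polynomial.eval_comp] at *
    omega
  · rw [Prog.out_seq, hf]
    congr 1; funext a; exact hg a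

theorem Feasible.prod {F G : Data → PMF Data} (hF : Feasible F) (hG : Feasible G) :
    Feasible fun x => (F x).bind fun a => (G x).bind fun b => PMF.pure (.pair a b) := by
  obtain ⟨f, ⟨p, hp⟩, hf⟩ := hF
  obtain ⟨g, ⟨q, hq⟩, hg⟩ := hG
  refine ⟨.pair f g, ⟨2 + Polynomial.X + 2 * p + 2 * q, fun x o ho => ?_⟩, fun x => ?_⟩
  · simp only [Prog.run, PMF.mem_support_bind_iff, PMF.mem_support_pure_iff] at ho
    obtain ⟨a, ha, b, hb, rfl⟩ := ho
    have h1 := hp x a ha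
    have h2 := hq x b hb
    have h3 := f.size_le_cost x a ha
    have h4 := g.size_le_cost x b hb
    simp only [Polynomial.eval_add, Polynomial.eval_mul, Polynomial.eval_X,
      Polynomial.eval_ofNat, Data.size] at *
    omega
  · rw [Prog.out_pair, hf]
    simp only [hg]

theorem FeasibleFun.of_eq {f g : Data → Data} (hf : FeasibleFun f) (h : ∀ x, f x = g x) :
    FeasibleFun g := by
  rwa [show g = f from funext fun x => (h x).symm]

theorem Feasible.of_eq {f g : Data → PMF Data} (hf : Feasible f) (h : ∀ x, f x = g x) :
    Feasible g := by
  rwa [show g = f from funext fun x => (h x).symm]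

theorem FeasibleFun.id : FeasibleFun fun x => x := Op.id.feasibleFun

theorem FeasibleFun.const (d : Data) : FeasibleFun fun _ => d := (Op.const d).feasibleFun

theorem Feasible.comp_fun {F : Data → PMF Data} {f : Data → Data} (hF : Feasible F)
    (hf : FeasibleFun f) : Feasible fun x => F (f x) :=
  (Feasible.comp hf hF).of_eq fun x => by rw [PMF.pure_bind]

theorem FeasibleFun.comp {g f : Data → Data} (hg : FeasibleFun g) (hf : FeasibleFun f) :
    FeasibleFun fun x => g (f x) :=
  Feasible.comp_fun (F := fun x => PMF.pure (g x)) hg hf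

theorem FeasibleFun.pair {f g : Data → Data} (hf : FeasibleFun f) (hg : FeasibleFun g) :
    FeasibleFun fun x => .pair (f x) (g x) :=
  (Feasible.prod hf hg).of_eq fun x => by simp only [PMF.pure_bind]

theorem FeasibleFun.fst {f : Data → Data} (hf : FeasibleFun f) : FeasibleFun fun x => (f x).fst :=
  Op.fst.feasibleFun.comp hf

theorem FeasibleFun.snd {f : Data → Data} (hf : FeasibleFun f) : FeasibleFun fun x => (f x).snd :=
  Op.snd.feasibleFun.comp hf

/-- Numbers computed by a polynomial time program. -/
def FeasibleNum (f : Data → ℕ) : Prop := FeasibleFun fun x => .num (f x)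

theorem FeasibleNum.num {f : Data → ℕ} (hf : FeasibleNum f) : FeasibleFun fun x => .num (f x) := hf

theorem FeasibleNum.const (k : ℕ) : FeasibleNum fun _ => k := FeasibleFun.const _

theorem FeasibleNum.add {f g : Data → ℕ} (hf : FeasibleNum f) (hg : FeasibleNum g) :
    FeasibleNum fun x => f x + g x :=
  Op.add.feasibleFun.comp (FeasibleFun.pair hf hg)

theorem FeasibleNum.sub {f g : Data → ℕ} (hf : FeasibleNum f) (hg : FeasibleNum g) :
    FeasibleNum fun x => f x - g x :=
  Op.sub.feasibleFun.comp (FeasibleFun.pair hf hg)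

theorem FeasibleNum.mul {f g : Data → ℕ} (hf : FeasibleNum f) (hg : FeasibleNum g) :
    FeasibleNum fun x => f x * g x :=
  Op.mul.feasibleFun.comp (FeasibleFun.pair hf hg)

theorem FeasibleNum.div {f g : Data → ℕ} (hf : FeasibleNum f) (hg : FeasibleNum g) :
    FeasibleNum fun x => f x / g x :=
  Op.div.feasibleFun.comp (FeasibleFun.pair hf hg)

theorem FeasibleNum.mod {f g : Data → ℕ} (hf : FeasibleNum f) (hg : FeasibleNum g) :
    FeasibleNum fun x => f x % g x :=
  Op.mod.feasibleFun.comp (FeasibleFun.pair hf hg)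

/-- The language has no conversion to a number, but arithmetic reads its arguments through
`Data.val`, so adding `0` performs it. -/
theorem FeasibleNum.val {f : Data → Data} (hf : FeasibleFun f) : FeasibleNum fun x => (f x).val :=
  (Op.add.feasibleFun.comp (FeasibleFun.pair hf (FeasibleFun.const (.num 0)))).of_eq
    fun x => by simp [Op.eval, Data.fst, Data.snd, Data.val]

theorem FeasibleNum.size {f : Data → Data} (hf : FeasibleFun f) :
    FeasibleNum fun x => (f x).size :=
  Op.size.feasibleFun.comp hf

theorem FeasibleFun.val {f : Data → Data} (hf : FeasibleFun f) : FeasibleNum fun x => (f x).val :=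
  FeasibleNum.val hf

/-- Predicates decided by a polynomial time program. -/
def FeasiblePred (p : Data → Prop) [DecidablePred p] : Prop :=
  FeasibleNum fun x => if p x then 1 else 0

theorem FeasiblePred.le {f g : Data → ℕ} (hf : FeasibleNum f) (hg : FeasibleNum g) :
    FeasiblePred fun x => f x ≤ g x :=
  Op.le.feasibleFun.comp (FeasibleFun.pair hf hg)

theorem FeasiblePred.and {p q : Data → Prop} [DecidablePred p] [DecidablePred q]
    (hp : FeasiblePred p) (hq : FeasiblePred q) : FeasiblePred fun x => p x ∧ q x :=
  FeasibleFun.of_eq (FeasibleNum.mul hp hq) fun x => by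
    by_cases h1 : p x <;> by_cases h2 : q x <;> simp [h1, h2]

theorem FeasiblePred.not {p : Data → Prop} [DecidablePred p]
    (hp : FeasiblePred p) : FeasiblePred fun x => ¬ p x :=
  FeasibleFun.of_eq (FeasibleNum.sub (FeasibleNum.const 1) hp) fun x => by
    by_cases h1 : p x <;> simp [h1]

theorem FeasiblePred.of_iff {p q : Data → Prop} [DecidablePred p] [DecidablePred q]
    (hp : FeasiblePred p) (h : ∀ x, p x ↔ q x) : FeasiblePred q :=
  FeasibleFun.of_eq hp fun x => by simp [h x]

theorem FeasiblePred.or {p q : Data → Prop} [DecidablePred p] [DecidablePred q]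
    (hp : FeasiblePred p) (hq : FeasiblePred q) : FeasiblePred fun x => p x ∨ q x :=
  (hp.not.and hq.not).not.of_iff fun x => by tauto

theorem FeasiblePred.lt {f g : Data → ℕ} (hf : FeasibleNum f) (hg : FeasibleNum g) :
    FeasiblePred fun x => f x < g x :=
  (FeasiblePred.le hg hf).not.of_iff fun x => by omega

theorem FeasiblePred.eq {f g : Data → ℕ} (hf : FeasibleNum f) (hg : FeasibleNum g) :
    FeasiblePred fun x => f x = g x :=
  ((FeasiblePred.le hf hg).and (FeasiblePred.le hg hf)).of_iff fun x => by omega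

/-- Whether a piece of data is a pair. -/
def Data.IsPair : Data → Prop
  | .num _ => False
  | .pair _ _ => True

instance : DecidablePred Data.IsPair
  | .num _ => isFalse id
  | .pair _ _ => isTrue trivial

theorem Op.eval_isPair : ∀ x : Data, Op.isPair.eval x = .num (if x.IsPair then 1 else 0)
  | .num _ => by rw [if_neg (by simp [Data.IsPair])]; rfl
  | .pair _ _ => by rw [if_pos (by simp [Data.IsPair])]; rfl

theorem FeasiblePred.isPair {f : Data → Data} (hf : FeasibleFun f) :
    FeasiblePred fun x => (f x).IsPair :=
  FeasibleFun.of_eq (Op.isPair.feasibleFun.comp hf) fun x => Op.eval_isPair (f x)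

theorem Feasible.ite {p : Data → Prop} [DecidablePred p] {F G : Data → PMF Data}
    (hp : FeasiblePred p) (hF : Feasible F) (hG : Feasible G) :
    Feasible fun x => if p x then F x else G x := by
  obtain ⟨c, ⟨s, hs⟩, hc⟩ := hp
  obtain ⟨f, ⟨p', hp'⟩, hf⟩ := hF
  obtain ⟨g, ⟨q, hq⟩, hg⟩ := hG
  refine ⟨.ite c f g, ⟨1 + s + p' + q, fun x o ho => ?_⟩, fun x => ?_⟩
  · simp only [Prog.run, PMF.mem_support_bind_iff, PMF.mem_support_pure_iff] at ho
    obtain ⟨a, ha, b, hb, rfl⟩ := ho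
    have h1 := hs x a ha
    have h2 : b.2 ≤ p'.eval x.size + q.eval x.size := by
      split_ifs at hb
      · exact (hp' x b hb).trans (by omega)
      · exact (hq x b hb).trans (by omega)
    simp only [Polynomial.eval_add, Polynomial.eval_one] at *
    omega
  · rw [Prog.out_ite, hc, PMF.pure_bind, hf, hg]
    by_cases h : p x <;> simp [h, Data.val]

theorem FeasibleFun.ite {p : Data → Prop} [DecidablePred p] {f g : Data → Data}
    (hp : FeasiblePred p) (hf : FeasibleFun f) (hg : FeasibleFun g) :
    FeasibleFun fun x => if p x then f x else g x :=
  (Feasible.ite hp hf hg).of_eq fun x => by by_cases h : p x <;> simp [h]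

theorem Feasible.bind {F : Data → PMF Data} {G : Data → Data → PMF Data} (hF : Feasible F)
    (hG : Feasible fun y => G y.fst y.snd) : Feasible fun x => (F x).bind fun a => G x a :=
  (Feasible.comp (Feasible.prod FeasibleFun.id hF) hG).of_eq fun x => by
    simp only [PMF.pure_bind, PMF.bind_bind, Data.fst, Data.snd]

/-- Equality occurs only for `n = 0`, where `unif` defaults to the point mass at `0`. -/
theorem unif_size_le (n r : ℕ) (h : r ∈ (unif (Finset.range n)).support) : r ≤ n := by
  unfold unif at h
  split_ifs at h with h0
  · rw [PMF.mem_support_uniformOfFinset_iff, Finset.mem_range] at h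
    exact h.le
  · rw [PMF.mem_support_pure_iff] at h
    omega

theorem feasible_rand : Feasible fun x =>
    (unif (Finset.range x.val)).bind fun r => PMF.pure (.num r) := by
  refine ⟨.rand, ⟨1 + 2 * Polynomial.X, fun x o ho => ?_⟩, Prog.out_rand⟩
  simp only [Prog.run, PMF.mem_support_bind_iff, PMF.mem_support_pure_iff] at ho
  obtain ⟨a, ha, rfl⟩ := ho
  have h1 := Data.num_size_mono (unif_size_le _ _ ha)
  have h2 := x.num_val_size_le
  simp only [Polynomial.eval_add, Polynomial.eval_one, Polynomial.eval_mul,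
    Polynomial.eval_ofNat, Polynomial.eval_X]
  omega

theorem Feasible.bind_unif {f : Data → ℕ} {G : Data → ℕ → PMF Data} (hf : FeasibleNum f)
    (hG : Feasible fun y => G y.fst y.snd.val) :
    Feasible fun x => (unif (Finset.range (f x))).bind fun r => G x r := by
  have h1 : Feasible fun x => (unif (Finset.range (f x))).bind fun r => PMF.pure (.num r) :=
    (feasible_rand.comp_fun hf).of_eq fun x => by simp only [Data.val]
  exact (Feasible.bind (G := fun x a => G x a.val) h1 hG).of_eq fun x => by
    simp only [PMF.bind_bind, PMF.pure_bind, Data.val]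

theorem FeasibleNum.natPoly (b : Polynomial ℕ) {f : Data → ℕ} (hf : FeasibleNum f) :
    FeasibleNum fun x => b.eval (f x) := by
  induction b using Polynomial.induction_on with
  | C a => simpa using FeasibleNum.const a
  | add p q hp hq => simpa using hp.add hq
  | monomial n a h =>
      refine FeasibleFun.of_eq (h.mul hf) fun x => ?_
      simp only [Polynomial.eval_mul, Polynomial.eval_C, Polynomial.eval_pow,
        Polynomial.eval_X]
      ring_nf

/-! ### Recursion and iteration -/

/-- With the sizes of all partial results bounded, every node of the tree costs at most a fixed
amount, and the number of nodes is at most the size of the tree. -/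
theorem Feasible.recur {F G : Data → PMF Data} (hF : Feasible F) (hG : Feasible G)
    (B : Polynomial ℕ)
    (hB : ∀ c t, ∀ o ∈ (recurOut F G c t).support, o.size ≤ B.eval (t.size + c.size)) :
    Feasible fun x => recurOut F G x.snd x.fst := by
  obtain ⟨f, ⟨p, hp⟩, hf⟩ := hF
  obtain ⟨g, ⟨q, hq⟩, hg⟩ := hG
  obtain rfl : f.out = F := funext hf
  obtain rfl : g.out = G := funext hg
  clear hf hg
  -- The bound `s` is kept fixed over all subtrees, so that the cost per node is uniform. The input
  -- of `g` consists of tree and parameter (at most `s`), two results (at most `B.eval s` each) and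
  -- three more pair nodes.
  have key : ∀ (c : Data) (s : ℕ) (t : Data), t.size + c.size ≤ s →
      ∀ o ∈ (recurCost f.run g.run c t).support,
        o.2 ≤ t.size * (p.eval (s + 1) + q.eval (s + 2 * B.eval s + 3)) := by
    intro c s t
    have hsup : ∀ t, ∀ o ∈ (recurCost f.run g.run c t).support,
        o.1 ∈ (recurOut f.out g.out c t).support := by
      intro t o ho
      have := recurCost_map_fst f.run g.run c t
      change _ = recurOut f.out g.out c t at this
      rw [← this, PMF.mem_support_map_iff]
      exact ⟨o, ho, rfl⟩
    induction t with
    | num k =>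
        intro hs o ho
        have h1 := hp _ o ho
        have h2 : (Data.pair (.num k) c).size ≤ s + 1 := by
          simp only [Data.size] at *; omega
        have h3 := h1.trans (natPoly_mono p h2)
        have h4 := (Data.num k).one_le_size
        simp only at h3
        nlinarith
    | pair a b iha ihb =>
        intro hs o ho
        simp only [Data.size] at hs
        simp only [recurCost, PMF.mem_support_bind_iff, PMF.mem_support_pure_iff] at ho
        obtain ⟨ra, hra, rb, hrb, u, hu, rfl⟩ := ho
        have h1 := iha (by omega) ra hra
        have h2 := ihb (by omega) rb hrb
        have h3 := hq _ u hu
        have sa := (hB c a _ (hsup a _ hra)).trans (natPoly_mono B (show _ ≤ s by omega))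
        have sb := (hB c b _ (hsup b _ hrb)).trans (natPoly_mono B (show _ ≤ s by omega))
        have h4 : (Data.pair (.pair a b) (.pair (.pair ra.1 rb.1) c)).size
            ≤ s + 2 * B.eval s + 3 := by
          simp only [Data.size] at *; omega
        have h5 := h3.trans (natPoly_mono q h4)
        simp only [Data.size] at *
        nlinarith
  refine ⟨.recur f g, ⟨1 + Polynomial.X + Polynomial.X *
    (p.comp (Polynomial.X + 1 + 1) + q.comp (Polynomial.X + 1 + 2 * B.comp (Polynomial.X + 1) + 3)),
    fun x o ho => ?_⟩, Prog.out_recur f g⟩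
  simp only [Prog.run, PMF.mem_support_bind_iff, PMF.mem_support_pure_iff] at ho
  obtain ⟨a, ha, rfl⟩ := ho
  -- A bare number has two projections `num 0` of size one each, hence the `+ 1`.
  have hx : x.fst.size + x.snd.size ≤ x.size + 1 := by
    cases x <;> simp [Data.fst, Data.snd, Data.size]
    omega
  have h1 := key x.snd (x.size + 1) x.fst hx a ha
  have h2 := Nat.mul_le_mul_right
    (p.eval (x.size + 1 + 1) + q.eval (x.size + 1 + 2 * B.eval (x.size + 1) + 3)) x.fst_size_le
  simp only [Polynomial.eval_add, Polynomial.eval_mul, Polynomial.eval_comp,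
    Polynomial.eval_one, Polynomial.eval_X, Polynomial.eval_ofNat]
  omega

theorem recurOut_pure {f g : Data → Data} {r : Data → Data → Data} {c : Data}
    (hn : ∀ k, r c (.num k) = f (.pair (.num k) c))
    (hp : ∀ a b, r c (.pair a b) = g (.pair (.pair a b) (.pair (.pair (r c a) (r c b)) c))) :
    ∀ t, recurOut (fun x => PMF.pure (f x)) (fun x => PMF.pure (g x)) c t = PMF.pure (r c t)
  | .num k => by simp only [recurOut, hn]
  | .pair a b => by
      simp only [recurOut, recurOut_pure hn hp a, recurOut_pure hn hp b, PMF.pure_bind, hp]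

/-- Functions defined by structural recursion with polynomially bounded values. -/
theorem FeasibleFun.recur {f g : Data → Data} {r : Data → Data → Data} (hf : FeasibleFun f)
    (hg : FeasibleFun g) (B : Polynomial ℕ)
    (hn : ∀ c k, r c (.num k) = f (.pair (.num k) c))
    (hp : ∀ c a b, r c (.pair a b) = g (.pair (.pair a b) (.pair (.pair (r c a) (r c b)) c)))
    (hB : ∀ c t, (r c t).size ≤ B.eval (t.size + c.size)) :
    FeasibleFun fun x => r x.snd x.fst := by
  have key : ∀ c t, recurOut (fun x => PMF.pure (f x)) (fun x => PMF.pure (g x)) c t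
      = PMF.pure (r c t) := fun c => recurOut_pure (hn c) (hp c)
  refine Feasible.of_eq (Feasible.recur hf hg B fun c t o ho => ?_) fun x => key _ _
  rw [key, PMF.mem_support_pure_iff] at ho
  rw [ho]
  exact hB c t

/-- Run a kernel on every cell of a list, that is, on every element together with the part of the
list that follows it. -/
def mapCells (F : Data → Data → PMF Data) : Data → PMF Data
  | .num _ => PMF.pure (.num 0)
  | .pair a b => (F a b).bind fun o => (mapCells F b).bind fun os => PMF.pure (.pair o os)

theorem mapCells_size {F : Data → Data → PMF Data} {s : ℕ} : ∀ t : Data,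
    (∀ a b, (Data.pair a b).size ≤ t.size → ∀ o ∈ (F a b).support, o.size ≤ s) →
    ∀ o ∈ (mapCells F t).support, o.size ≤ t.size * (s + 1)
  | .num k, _, o, ho => by
      simp only [mapCells, PMF.mem_support_pure_iff] at ho
      have := (Data.num k).one_le_size
      have h2 : (Data.num 0).size = 1 := by simp [Data.size]
      rw [ho, h2]
      nlinarith
  | .pair a b, hF, o, ho => by
      simp only [mapCells, PMF.mem_support_bind_iff, PMF.mem_support_pure_iff] at ho
      obtain ⟨q, hq, os, hos, rfl⟩ := ho
      have h1 := hF a b le_rfl q hq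
      have h2 := mapCells_size b (fun a' b' h => hF a' b' (by
        simp only [Data.size] at *; omega)) os hos
      simp only [Data.size]
      nlinarith

/-- A list is a right comb, but the recursion also enters the heads. The result obtained there is
sampled and discarded, which does not affect the distribution. -/
theorem Feasible.mapCells {K : Data → PMF Data} (hK : Feasible K) :
    Feasible fun x => mapCells (fun a b => K (.pair (.pair a b) x.snd)) x.fst := by
  obtain ⟨p, hp⟩ := hK.exists_size_le
  let G : Data → PMF Data := fun y => (K (.pair y.fst y.snd.snd)).bind fun o =>
    PMF.pure (.pair o y.snd.fst.snd)
  have hG : Feasible G := Feasible.bind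
    (hK.comp_fun (FeasibleFun.id.fst.pair FeasibleFun.id.snd.snd))
    (FeasibleFun.id.snd.pair FeasibleFun.id.fst.snd.fst.snd)
  have hGe : ∀ a b ra rb c, G (.pair (.pair a b) (.pair (.pair ra rb) c)) =
      (K (.pair (.pair a b) c)).bind fun o => PMF.pure (.pair o rb) := fun _ _ _ _ _ => rfl
  have key : ∀ c t, recurOut (fun _ => PMF.pure (.num 0)) G c t
      = RevFRF.mapCells (fun a b => K (.pair (.pair a b) c)) t := by
    intro c t
    induction t with
    | num k => rfl
    | pair a b _ ihb =>
        simp only [recurOut, RevFRF.mapCells, ihb, hGe, PMF.bind_const]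
        rw [PMF.bind_comm]
  refine (Feasible.recur (FeasibleFun.const (.num 0)) hG
    (Polynomial.X * (p.comp (Polynomial.X + 1) + 1)) fun c t o ho => ?_).of_eq fun x => key _ _
  rw [key] at ho
  have := mapCells_size (s := p.eval (t.size + c.size + 1)) t (fun a b h o ho =>
    (hp _ o ho).trans (natPoly_mono p (by simp only [Data.size] at *; omega))) o ho
  simp only [Polynomial.eval_mul, Polynomial.eval_X, Polynomial.eval_add, Polynomial.eval_one,
    Polynomial.eval_comp]
  exact this.trans (Nat.mul_le_mul_right _ (by omega))

theorem Feasible.mapCells' {K : Data → Data → Data → PMF Data} {f : Data → Data}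
    (hK : Feasible fun y => K y.snd y.fst.fst y.fst.snd) (hf : FeasibleFun f) :
    Feasible fun x => RevFRF.mapCells (K x) (f x) :=
  ((Feasible.mapCells hK).comp_fun (hf.pair FeasibleFun.id)).of_eq fun x => by
    simp only [Data.fst, Data.snd]

theorem mapCells_pure (F : Data → Data) : ∀ t : Data,
    RevFRF.mapCells (fun a _ => PMF.pure (F a)) t = PMF.pure (.ofList (t.toList.map F))
  | .num _ => rfl
  | .pair a b => by
      simp only [RevFRF.mapCells, mapCells_pure F b, PMF.pure_bind]
      rfl

theorem FeasibleFun.map {F : Data → Data → Data} {f : Data → Data}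
    (hF : FeasibleFun fun y => F y.snd y.fst) (hf : FeasibleFun f) :
    FeasibleFun fun x => .ofList ((f x).toList.map (F x)) :=
  (Feasible.mapCells' (K := fun x a _ => PMF.pure (F x a)) (f := f)
    (hF.comp (FeasibleFun.id.fst.fst.pair FeasibleFun.id.snd)) hf).of_eq fun _ =>
    mapCells_pure _ _

@[simp] theorem Data.toList_ofList (l : List Data) : (Data.ofList l).toList = l := by
  induction l with
  | nil => rfl
  | cons a l ih => simp [Data.ofList, Data.toList, ih]

/-- Concatenation of lists. -/
def Data.append (s t : Data) : Data := .ofList (s.toList ++ t.toList)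

theorem Data.size_ofList_toList_le (t : Data) : (Data.ofList t.toList).size ≤ t.size := by
  induction t with
  | num k => simp [Data.toList, Data.ofList, Data.size]
  | pair a b _ ih => simp only [Data.toList, Data.ofList, Data.size] at *; omega

theorem Data.size_ofList_append (l m : List Data) :
    (Data.ofList (l ++ m)).size + 1 = (Data.ofList l).size + (Data.ofList m).size := by
  induction l with
  | nil => simp [Data.ofList, Data.size]; omega
  | cons a l ih => simp only [List.cons_append, Data.ofList, Data.size] at *; omega

theorem FeasibleFun.ofList_toList {f : Data → Data} (hf : FeasibleFun f) :
    FeasibleFun fun x => .ofList (f x).toList :=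
  (FeasibleFun.map (F := fun _ a => a) FeasibleFun.id.fst hf).of_eq fun x => by simp

theorem FeasibleFun.append {f g : Data → Data} (hf : FeasibleFun f) (hg : FeasibleFun g) :
    FeasibleFun fun x => (f x).append (g x) := by
  have h : FeasibleFun fun x => Data.append x.fst x.snd := by
    refine FeasibleFun.recur (r := fun c t => Data.append t c) (f := fun y => .ofList y.snd.toList)
      (g := fun y => .pair y.fst.fst y.snd.fst.snd) FeasibleFun.id.snd.ofList_toList
      (FeasibleFun.id.fst.fst.pair FeasibleFun.id.snd.fst.snd) Polynomial.X ?_ ?_ ?_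
    · intro c k; rfl
    · intro c a b; rfl
    · intro c t
      have h1 := Data.size_ofList_append t.toList c.toList
      have h2 := t.size_ofList_toList_le
      have h3 := c.size_ofList_toList_le
      simp only [Data.append, Polynomial.eval_X]
      omega
  exact h.comp (hf.pair hg)

theorem iterOut_pure (f : Data → Data) : ∀ (k : ℕ) (s : Data),
    iterOut (fun x => PMF.pure (f x)) k s = PMF.pure (f^[k] s)
  | 0, s => rfl
  | k + 1, s => by
      simp only [iterOut, PMF.pure_bind, iterOut_pure f k, Function.iterate_succ_apply]

/-- The cost may be random while the state is not, so it suffices to bound the cost along the orbit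
of `f`. -/
theorem iterCost_le {f : Data → Data} {F : Data → PMF (Data × ℕ)}
    (hF : ∀ x, (F x).map Prod.fst = PMF.pure (f x)) {W : ℕ} : ∀ (k : ℕ) (s : Data),
    (∀ i < k, ∀ o ∈ (F (f^[i] s)).support, o.2 ≤ W) →
    ∀ o ∈ (iterCost F k s).support, o.2 ≤ k * W
  | 0, s, _, o, ho => by
      simp only [iterCost, PMF.mem_support_pure_iff] at ho
      simp [ho]
  | k + 1, s, h, o, ho => by
      simp only [iterCost, PMF.mem_support_bind_iff, PMF.mem_support_pure_iff] at ho
      obtain ⟨a, ha, b, hb, rfl⟩ := ho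
      have h1 := h 0 (by omega) a ha
      have h0 : a.1 = f s := by
        have : a.1 ∈ ((F s).map Prod.fst).support := by
          rw [PMF.mem_support_map_iff]; exact ⟨a, ha, rfl⟩
        rwa [hF, PMF.mem_support_pure_iff] at this
      have h2 := iterCost_le hF k a.1 (fun i hi o ho => h (i + 1) (by omega) o (by
        rwa [Function.iterate_succ_apply, ← h0])) b hb
      simp only
      nlinarith

/-- Iterations of polynomial length whose intermediate states are polynomially bounded. -/
theorem FeasibleFun.iterate {f s : Data → Data} {cnt : Data → ℕ} (hf : FeasibleFun f)
    (hs : FeasibleFun s) (hcnt : FeasibleNum cnt) (C B : Polynomial ℕ)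
    (hC : ∀ x, cnt x ≤ C.eval x.size)
    (hB : ∀ x, ∀ i < cnt x, (f^[i] (s x)).size ≤ B.eval x.size) :
    FeasibleFun fun x => f^[cnt x] (s x) := by
  obtain ⟨P, ⟨p, hp⟩, hP⟩ := hf
  obtain ⟨S, ⟨q, hq⟩, hS⟩ := FeasibleFun.pair hcnt hs
  have hloop : ∀ x, (Prog.seq S (.loop P)).out x = PMF.pure (f^[cnt x] (s x)) := by
    intro x
    rw [Prog.out_seq, hS, PMF.pure_bind, Prog.out_loop, funext hP, iterOut_pure]
    rfl
  refine ⟨.seq S (.loop P), ⟨2 + 2 * q + C * p.comp B, fun x o ho => ?_⟩, hloop⟩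
  simp only [Prog.run, PMF.mem_support_bind_iff, PMF.mem_support_pure_iff] at ho
  obtain ⟨a, ha, _, ⟨b, hb, rfl⟩, rfl⟩ := ho
  have h0 : a.1 = .pair (.num (cnt x)) (s x) := by
    have := Prog.fst_mem_support_out ha
    rwa [hS, PMF.mem_support_pure_iff] at this
  have h1 := hq x a ha
  have h2 := S.size_le_cost x a ha
  rw [h0] at hb h2
  simp only [Data.fst, Data.snd, Data.val] at hb
  have h3 := iterCost_le (F := P.run) (f := f) hP (W := p.eval (B.eval x.size)) _ _
    (fun i hi o ho => (hp _ o ho).trans (natPoly_mono p (hB x i hi))) b hb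
  have h4 := Nat.mul_le_mul_right (p.eval (B.eval x.size)) (hC x)
  simp only [Polynomial.eval_add, Polynomial.eval_mul, Polynomial.eval_comp,
    Polynomial.eval_ofNat, h0]
  omega

/-! ### Modular arithmetic -/

/-- The modulus `N²`, replaced by `1` if `N = 0`. -/
def modulus (N : ℕ) : ℕ := N * N + (1 - N * N)

theorem modulus_pos (N : ℕ) : 0 < modulus N := by unfold modulus; omega

theorem modulus_eq {N : ℕ} (h : 0 < N) : modulus N = N ^ 2 := by
  have : 0 < N * N := by positivity
  unfold modulus
  rw [sq]
  omega

/-- One step of fast modular exponentiation, on states `(base, exponent, result, modulus)`. -/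
def powStep (s : Data) : Data :=
  .pair (.num (s.fst.val * s.fst.val % s.snd.snd.snd.val))
    (.pair (.num (s.snd.fst.val / 2))
      (.pair (.num (s.snd.snd.fst.val *
          ((1 - s.snd.fst.val % 2) + s.snd.fst.val % 2 * s.fst.val) % s.snd.snd.snd.val))
        (.num s.snd.snd.snd.val)))

/-- The states of fast modular exponentiation. -/
def powState (b e a M : ℕ) : Data := .pair (.num b) (.pair (.num e) (.pair (.num a) (.num M)))

theorem powStep_powState (b e a M : ℕ) : powStep (powState b e a M) =
    powState (b * b % M) (e / 2) (a * ((1 - e % 2) + e % 2 * b) % M) M := rfl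

/-- Square and multiply: `a * b ^ e` modulo `M` is invariant, and `k` halvings exhaust an exponent
below `2 ^ k`. The sum `(1 - e % 2) + e % 2 * b` is a branch-free form of `b ^ (e % 2)`. The final
reduction is needed for `k = 0`, where `a` has not been reduced yet. -/
theorem powStep_iterate : ∀ (k b e a M : ℕ), e < 2 ^ k →
    (powStep^[k] (powState b e a M)).snd.snd.fst.val % M = a * b ^ e % M
  | 0, b, e, a, M, h => by
      obtain rfl : e = 0 := by simpa using h
      simp [powState, Data.fst, Data.snd, Data.val]
  | k + 1, b, e, a, M, h => by
      rw [Function.iterate_succ_apply, powStep_powState,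
        powStep_iterate k _ _ _ _ (by rw [pow_succ] at h; omega)]
      have h1 : b ^ e = b ^ (e % 2) * (b * b) ^ (e / 2) := by
        conv_lhs => rw [← Nat.mod_add_div e 2]
        rw [pow_add, pow_mul, sq]
      have h2 : (1 - e % 2) + e % 2 * b = b ^ (e % 2) := by
        rcases Nat.mod_two_eq_zero_or_one e with h | h <;> simp [h]
      rw [h2, h1]
      have h3 : (b * b % M) ^ (e / 2) ≡ (b * b) ^ (e / 2) [MOD M] := (Nat.mod_modEq _ _).pow _
      have h4 : a * b ^ (e % 2) % M ≡ a * b ^ (e % 2) [MOD M] := Nat.mod_modEq _ _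
      have h5 := h4.mul h3
      rw [mul_assoc] at h5
      exact h5

/-- Products are reduced modulo `M` at once. Positivity of `M` matters: since `x % 0 = x`, squaring
would otherwise double the length in every step. -/
theorem powStep_iterate_size {U M : ℕ} (hM : 0 < M) (hU : M ≤ U) : ∀ (k b e a : ℕ),
    b ≤ U → e ≤ U → a ≤ U →
    (powStep^[k] (powState b e a M)).size ≤ 4 * (Data.num U).size + 3
  | 0, b, e, a, hb, he, ha => by
      have h1 := Data.num_size_mono hb
      have h2 := Data.num_size_mono he
      have h3 := Data.num_size_mono ha
      have h4 := Data.num_size_mono hU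
      simp only [Function.iterate_zero, id, powState]
      simp only [Data.size] at *
      omega
  | k + 1, b, e, a, hb, he, ha => by
      rw [Function.iterate_succ_apply, powStep_powState]
      exact powStep_iterate_size hM hU k _ _ _ ((Nat.mod_lt _ hM).le.trans hU)
        ((Nat.div_le_self _ _).trans he) ((Nat.mod_lt _ hM).le.trans hU)

theorem FeasibleNum.pow_mod {b e N : Data → ℕ} (hb : FeasibleNum b) (he : FeasibleNum e)
    (hN : FeasibleNum N) : FeasibleNum fun x => b x ^ e x % modulus (N x) := by
  have hM : FeasibleNum fun x => modulus (N x) :=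
    (hN.mul hN).add ((FeasibleNum.const 1).sub (hN.mul hN))
  have hid := FeasibleFun.id
  have hstep : FeasibleFun powStep :=
    ((hid.fst.val.mul hid.fst.val).mod hid.snd.snd.snd.val).pair <|
      (hid.snd.fst.val.div (.const 2)).num.pair <|
        FeasibleFun.pair ((hid.snd.snd.fst.val.mul
          (((FeasibleNum.const 1).sub (hid.snd.fst.val.mod (.const 2))).add
            ((hid.snd.fst.val.mod (.const 2)).mul hid.fst.val))).mod hid.snd.snd.snd.val)
          hid.snd.snd.snd.val
  -- A common bound for the base, the exponent, the modulus and the initial accumulator `1`.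
  have hU := (((hb.add he).add hM).add (.const 1))
  -- The size of the exponent as data is its bit length plus one, so there are enough halvings.
  have hcnt : FeasibleNum fun x => (Data.num (e x)).size := FeasibleNum.size he
  have hs : FeasibleFun fun x => powState (b x) (e x) 1 (modulus (N x)) :=
    hb.num.pair (he.num.pair ((FeasibleNum.const 1).num.pair hM))
  obtain ⟨C, hC⟩ := FeasibleFun.exists_size_le he
  obtain ⟨B, hB⟩ := FeasibleFun.exists_size_le hU
  have := FeasibleFun.iterate hstep hs hcnt C (4 * B + 3) hC fun x i hi => by
    have h1 := powStep_iterate_size (U := b x + e x + modulus (N x) + 1) (modulus_pos (N x))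
      (by omega) i (b x) (e x) 1 (by omega) (by omega) (by omega)
    have h2 := hB x
    simp only at h2
    simp only [Polynomial.eval_add, Polynomial.eval_mul, Polynomial.eval_ofNat]
    omega
  refine FeasibleFun.of_eq (FeasibleNum.mod (FeasibleNum.val this.snd.snd.fst) hM) fun x => ?_
  simp only
  rw [powStep_iterate _ _ _ _ _ ?_, one_mul]
  exact (Nat.lt_size_self _).trans_le (Nat.pow_le_pow_right (by norm_num) (by simp [Data.size]))

/-! ### Reading the destroyed splits from the input -/

/-- Attach to every split its provider. -/
def Tree.label {n : ℕ} {σ : Type} : Tree n σ → Tree n (Fin n × σ)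
  | .leaf => .leaf
  | .node u s l r => .node u (u, s) l.label r.label

/-- A split with its provider, as data. -/
def nodeData {n : ℕ} (a : Fin n × ℕ) : Data := .pair (.num a.1) (.num a.2)

/-- A list of splits with their providers, as data. -/
def nodesData {n : ℕ} (l : List (Fin n × ℕ)) : Data := .ofList (l.map nodeData)

/-- The splits of a tree given as data. -/
def splitsData (n : ℕ) (t : Data) : Data := nodesData (Tree.ofData n t).label.splits

/-- The destroyed splits of a tree given as data. -/
def destroyedData (n u : ℕ) (t : Data) : Data :=
  .ofList (((Tree.ofData n t).label.destroyed u).map nodesData)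

/-- Whether a pair is read as an inner node of a tree. -/
def IsNode (n : ℕ) (a b : Data) : Prop :=
  a.IsPair ∧ ¬ a.fst.IsPair ∧ ¬ a.snd.IsPair ∧ b.IsPair ∧ a.fst.val < n

instance (n : ℕ) (a b : Data) : Decidable (IsNode n a b) := by unfold IsNode; infer_instance

theorem nodesData_append {n : ℕ} (l m : List (Fin n × ℕ)) :
    nodesData (l ++ m) = (nodesData l).append (nodesData m) := by
  simp [nodesData, Data.append]

theorem Tree.ofData_of_not_isNode {n : ℕ} {a b : Data} (h : ¬ IsNode n a b) :
    Tree.ofData n (.pair a b) = .leaf := by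
  unfold Tree.ofData
  split
  · rename_i u m l r heq
    simp only [Data.pair.injEq] at heq
    obtain ⟨rfl, rfl⟩ := heq
    rw [dif_neg]
    intro hu
    exact h ⟨trivial, id, id, trivial, hu⟩
  · rfl

theorem IsNode.eq {n : ℕ} {a b : Data} (h : IsNode n a b) :
    ∃ u : Fin n, ∃ m l r, a = .pair (.num u) (.num m) ∧ b = .pair l r := by
  obtain ⟨h1, h2, h3, h4, h5⟩ := h
  match a, b, h1, h4 with
  | .pair x y, .pair l r, _, _ =>
    match x, y, h2, h3, h5 with
    | .num u, .num m, _, _, h5 => exact ⟨⟨u, h5⟩, m, l, r, rfl, rfl⟩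
    | .pair _ _, _, h2, _, _ => exact absurd trivial h2
    | .num _, .pair _ _, _, h3, _ => exact absurd trivial h3

theorem Tree.ofData_node {n : ℕ} (u : Fin n) (m : ℕ) (l r : Data) :
    Tree.ofData n (.pair (.pair (.num u) (.num m)) (.pair l r)) =
      .node u m (Tree.ofData n l) (Tree.ofData n r) := by
  rw [Tree.ofData, dif_pos u.2]

theorem splitsData_num (n k : ℕ) : splitsData n (.num k) = .num 0 := rfl

theorem destroyedData_num (n u k : ℕ) : destroyedData n u (.num k) = .num 0 := rfl

theorem splitsData_pair (n : ℕ) (a b : Data) : splitsData n (.pair a b) =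
    if IsNode n a b then .pair a ((splitsData n b.fst).append (splitsData n b.snd))
    else .num 0 := by
  split_ifs with h
  · obtain ⟨u, m, l, r, rfl, rfl⟩ := h.eq
    rw [splitsData, Tree.ofData_node, Tree.label, Tree.splits]
    simp only [splitsData, Data.fst, Data.snd, ← nodesData_append]
    rfl
  · rw [splitsData, Tree.ofData_of_not_isNode h]
    rfl

theorem destroyedData_pair (n u : ℕ) (a b : Data) : destroyedData n u (.pair a b) =
    if IsNode n a b then
      if a.fst.val = u then .pair (splitsData n (.pair a b)) (.num 0)
      else (destroyedData n u b.fst).append (destroyedData n u b.snd)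
    else .num 0 := by
  split_ifs with h h'
  · obtain ⟨v, m, l, r, rfl, rfl⟩ := h.eq
    simp only [Data.fst, Data.val] at h'
    rw [destroyedData, splitsData, Tree.ofData_node, Tree.label, Tree.destroyed, if_pos h']
    rfl
  · obtain ⟨v, m, l, r, rfl, rfl⟩ := h.eq
    simp only [Data.fst, Data.val] at h'
    rw [destroyedData, Tree.ofData_node, Tree.label, Tree.destroyed, if_neg h']
    simp [destroyedData, Data.append, Data.fst, Data.snd]
  · rw [destroyedData, Tree.ofData_of_not_isNode h]
    rfl

theorem Data.size_append_le (s t : Data) : (s.append t).size + 1 ≤ s.size + t.size := by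
  have h1 := Data.size_ofList_append s.toList t.toList
  have h2 := s.size_ofList_toList_le
  have h3 := t.size_ofList_toList_le
  simp only [Data.append]
  omega

/-- The splits below `pair a b` come from the two components of `b`, so the induction hypothesis has
to cover the components of a tree as well. -/
theorem splitsData_size_le (n : ℕ) (t : Data) : (splitsData n t).size ≤ t.size ∧
    (splitsData n t.fst).size ≤ t.size ∧ (splitsData n t.snd).size ≤ t.size ∧
    (splitsData n t.fst).size + (splitsData n t.snd).size ≤ t.size + 1 := by
  induction t with
  | num k => simp [splitsData_num, Data.fst, Data.snd, Data.size]
  | pair a b iha ihb =>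
      have h0 := Data.size_append_le (splitsData n b.fst) (splitsData n b.snd)
      have h1 : (splitsData n (.pair a b)).size ≤ (Data.pair a b).size := by
        rw [splitsData_pair]
        split_ifs
        · simp only [Data.size]
          omega
        · simp [Data.size]
      refine ⟨h1, ?_⟩
      simp only [Data.fst, Data.snd, Data.size] at *
      omega

/-- The factor `2` absorbs the list cell that wraps the splits of a destroyed root. -/
theorem destroyedData_size_le (n u : ℕ) (t : Data) :
    (destroyedData n u t).size ≤ 2 * t.size ∧
    (destroyedData n u t.fst).size + (destroyedData n u t.snd).size ≤ 2 * t.size + 1 := by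
  induction t with
  | num k => simp [destroyedData_num, Data.fst, Data.snd, Data.size]; omega
  | pair a b iha ihb =>
      have h0 := Data.size_append_le (destroyedData n u b.fst) (destroyedData n u b.snd)
      have h2 := (splitsData_size_le n (.pair a b)).1
      have h3 := a.one_le_size
      have h1 : (destroyedData n u (.pair a b)).size ≤ 2 * (Data.pair a b).size := by
        rw [destroyedData_pair]
        have : (Data.num 0).size = 1 := by simp [Data.size]
        split_ifs
        · rw [Data.size, this]
          have : 2 ≤ (Data.pair a b).size := by simp only [Data.size]; omega
          omega
        · simp only [Data.size]
          omega
        · rw [this]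
          simp only [Data.size]
          omega
      refine ⟨h1, ?_⟩
      simp only [Data.fst, Data.snd, Data.size] at *
      omega

theorem FeasiblePred.isNode (n : ℕ) {f g : Data → Data} (hf : FeasibleFun f)
    (hg : FeasibleFun g) : FeasiblePred fun x => IsNode n (f x) (g x) :=
  FeasiblePred.of_iff ((FeasiblePred.isPair hf).and <| (FeasiblePred.isPair hf.fst).not.and <|
    (FeasiblePred.isPair hf.snd).not.and <| (FeasiblePred.isPair hg).and <|
    FeasiblePred.lt hf.fst.val (.const n)) fun _ => Iff.rfl

/-- The children of a node are grandchildren in the data format, out of reach of plain structural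
recursion. The recursion therefore returns the values at `t`, `t.fst` and `t.snd` together. Both
functions are computed at once because destruction of a root uses its splits. -/
theorem feasibleFun_splitsData_destroyedData (n : ℕ) :
    FeasibleFun fun x => .pair (splitsData n x.fst) (destroyedData n x.snd.val x.fst) := by
  let V : Data → Data → Data := fun c t => .pair (splitsData n t) (destroyedData n c.val t)
  let r : Data → Data → Data := fun c t => .pair (V c t) (.pair (V c t.fst) (V c t.snd))
  let S : Data → Data → Data → Data → Data := fun a b p q =>
    if IsNode n a b then .pair a (p.fst.append q.fst) else .num 0
  let D : Data → Data → Data → Data → Data → Data := fun c a b p q =>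
    if IsNode n a b then
      if a.fst.val = c.val then .pair (S a b p q) (.num 0) else p.snd.append q.snd
    else .num 0
  have hV : ∀ c a b, V c (.pair a b) =
      .pair (S a b (V c b.fst) (V c b.snd)) (D c a b (V c b.fst) (V c b.snd)) := by
    intro c a b
    simp only [V, S, D, Data.fst, Data.snd, splitsData_pair, destroyedData_pair]
  let f0 : Data := .pair (.num 0) (.num 0)
  let g : Data → Data := fun y =>
    .pair (.pair (S y.fst.fst y.fst.snd y.snd.fst.snd.snd.fst y.snd.fst.snd.snd.snd)
      (D y.snd.snd y.fst.fst y.fst.snd y.snd.fst.snd.snd.fst y.snd.fst.snd.snd.snd))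
      (.pair y.snd.fst.fst.fst y.snd.fst.snd.fst)
  have h := FeasibleFun.id
  have hN : FeasiblePred fun y => IsNode n y.fst.fst y.fst.snd :=
    FeasiblePred.isNode n h.fst.fst h.fst.snd
  have hp : FeasibleFun fun y => y.snd.fst.snd.snd.fst := h.snd.fst.snd.snd.fst
  have hq : FeasibleFun fun y => y.snd.fst.snd.snd.snd := h.snd.fst.snd.snd.snd
  have hS : FeasibleFun fun y =>
      S y.fst.fst y.fst.snd y.snd.fst.snd.snd.fst y.snd.fst.snd.snd.snd :=
    FeasibleFun.ite hN (h.fst.fst.pair (hp.fst.append hq.fst)) (.const _)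
  have hD : FeasibleFun fun y =>
      D y.snd.snd y.fst.fst y.fst.snd y.snd.fst.snd.snd.fst y.snd.fst.snd.snd.snd :=
    FeasibleFun.ite hN (FeasibleFun.ite (FeasiblePred.eq h.fst.fst.fst.val h.snd.snd.val)
      (hS.pair (.const _)) (hp.snd.append hq.snd)) (.const _)
  have hg : FeasibleFun g :=
    (hS.pair hD).pair (h.snd.fst.fst.fst.pair h.snd.fst.snd.fst)
  have hr : FeasibleFun fun x => r x.snd x.fst := by
    refine FeasibleFun.recur (.const (.pair f0 (.pair f0 f0))) hg (9 * Polynomial.X + 10)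
      (fun c k => rfl) (fun c a b => ?_) fun c t => ?_
    · change Data.pair (V c (.pair a b)) (.pair (V c a) (V c b)) = _
      rw [hV]
      rfl
    · have h1 := splitsData_size_le n t
      have h2 := destroyedData_size_le n c.val t
      simp only [r, V, Data.size, Polynomial.eval_add, Polynomial.eval_mul, Polynomial.eval_X,
        Polynomial.eval_ofNat]
      omega
  exact hr.fst

/-- The destroyed splits of all trees of a forest given as data. -/
def forestData (n u : ℕ) (t : Data) : Data :=
  .ofList ((((t.toList.map (Tree.ofData n)).map Tree.label).flatMap
    (Tree.destroyed u)).map nodesData)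

theorem forestData_pair (n u : ℕ) (a b : Data) :
    forestData n u (.pair a b) = (destroyedData n u a).append (forestData n u b) := by
  simp [forestData, destroyedData, Data.append, Data.toList]

theorem forestData_size_le (n u : ℕ) : ∀ t : Data, (forestData n u t).size ≤ 2 * t.size
  | .num k => by simp [forestData, Data.toList, Data.ofList, Data.size]; omega
  | .pair a b => by
      have h1 := Data.size_append_le (destroyedData n u a) (forestData n u b)
      have h2 := (destroyedData_size_le n u a).1
      have h3 := forestData_size_le n u b
      rw [forestData_pair]
      simp only [Data.size]
      omega

theorem FeasibleFun.forestData (n : ℕ) {u : Data → ℕ} {t : Data → Data} (hu : FeasibleNum u)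
    (ht : FeasibleFun t) : FeasibleFun fun x => RevFRF.forestData n (u x) (t x) := by
  have h : FeasibleFun fun x => RevFRF.forestData n x.snd.val x.fst := by
    have h := FeasibleFun.id
    refine FeasibleFun.recur (r := fun c t => RevFRF.forestData n c.val t)
      (f := fun _ => .num 0)
      (g := fun y => (destroyedData n y.snd.snd.val y.fst.fst).append y.snd.fst.snd)
      (.const _) (FeasibleFun.append ?_ h.snd.fst.snd) (2 * Polynomial.X) (fun c k => rfl)
      (fun c a b => forestData_pair n _ a b) fun c t => ?_
    · exact ((feasibleFun_splitsData_destroyedData n).comp (h.fst.fst.pair h.snd.snd)).snd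
    · have := forestData_size_le n c.val t
      simp only [Polynomial.eval_mul, Polynomial.eval_X, Polynomial.eval_ofNat]
      omega
  exact h.comp (ht.pair hu.num)

/-- A message whose splits carry their providers, as data. -/
def messageData {n : ℕ} (m : Message (Fin n × ℕ)) : Data := .pair m.request (nodesData m.splits)

/-- The messages of the center server, with plain splits that carry their providers. -/
def plainMessages {n : ℕ} (inp : RevocInput n) : List (Message (Fin n × ℕ)) :=
  csMessages inp (inp.forest.map Tree.label)

theorem FeasibleFun.plainMessages (n : ℕ) : FeasibleFun fun d =>
    .ofList ((RevFRF.plainMessages (RevocInput.ofData n d)).map messageData) := by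
  have h := FeasibleFun.id
  have h1 : FeasibleFun fun d => if d.fst.val = 1 ∧ d.snd.fst.val = 1 then
      .ofList ((RevFRF.forestData n d.snd.snd.fst.val d.snd.snd.snd.snd).toList.map
        fun a => .pair d.snd.snd.snd.fst a) else .num 0 :=
    FeasibleFun.ite ((FeasiblePred.eq h.fst.val (.const 1)).and
      (FeasiblePred.eq h.snd.fst.val (.const 1)))
      (FeasibleFun.map (F := fun d a => .pair d.snd.snd.snd.fst a)
        (h.snd.snd.snd.snd.fst.pair h.fst)
        (FeasibleFun.forestData n h.snd.snd.fst.val h.snd.snd.snd.snd)) (.const _)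
  refine h1.of_eq fun d => ?_
  by_cases hd : d.fst.val = 1 ∧ d.snd.fst.val = 1
  · rw [if_pos hd]
    simp only [RevFRF.plainMessages, csMessages, RevocInput.ofData, hd.1, hd.2]
    simp [RevFRF.forestData, messageData, Function.comp_def]
  · rw [if_neg hd]
    rw [RevFRF.plainMessages, csMessages, if_neg (by simpa [RevocInput.ofData] using hd)]
    rfl

/-! ### Leakage in terms of labelled messages -/

theorem Tree.length_splits_label {n : ℕ} {σ : Type} : ∀ t : Tree n σ,
    t.label.splits.length = t.splits.length
  | .leaf => rfl
  | .node u s l r => by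
      simp [Tree.label, Tree.splits, Tree.length_splits_label l, Tree.length_splits_label r]

theorem Tree.length_destroyed_label {n : ℕ} {σ : Type} (u : ℕ) : ∀ t : Tree n σ,
    (t.label.destroyed u).map List.length = (t.destroyed u).map List.length
  | .leaf => rfl
  | .node v s l r => by
      have h := Tree.length_splits_label (.node v s l r)
      simp only [Tree.label] at h
      simp only [Tree.label, Tree.destroyed]
      split_ifs
      · simpa using h
      · simp [Tree.length_destroyed_label u l, Tree.length_destroyed_label u r]

/-- Only the lengths matter, and labelling preserves them. Both views thereby become functions of
`plainMessages`. -/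
theorem leakage_eq {n : ℕ} (inp : RevocInput n) : leakage inp =
    .ofList ((plainMessages inp).map fun m => .pair m.request (.unary m.splits.length)) := by
  have h : ∀ l : List (Tree n ℕ),
      ((l.map Tree.label).flatMap (Tree.destroyed inp.revoked)).map List.length =
        (l.flatMap (Tree.destroyed inp.revoked)).map List.length := by
    intro l
    induction l with
    | nil => rfl
    | cons t l ih => simp [Tree.length_destroyed_label, ih]
  unfold leakage plainMessages csMessages
  split_ifs
  · have := congrArg (List.map fun k => Data.pair inp.request (.unary k)) (h inp.forest)
    simp only [List.map_map, Function.comp_def] at this ⊢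
    rw [this]
  · rfl

/-! ### Sampling lists -/

theorem sampleList_append {α β : Type} (F : α → PMF β) : ∀ l m : List α,
    sampleList F (l ++ m) = (sampleList F l).bind fun x => (sampleList F m).map fun y => x ++ y
  | [], m => by
      simp only [List.nil_append, sampleList, PMF.pure_bind]
      exact (PMF.map_id _).symm
  | a :: l, m => by
      simp only [List.cons_append, sampleList, sampleList_append F l m, PMF.map, PMF.bind_bind,
        PMF.pure_bind, Function.comp_def]

theorem sampleList_map {α β γ : Type} (F : α → PMF β) (f : β → γ) : ∀ l : List α,
    sampleList (fun a => (F a).map f) l = (sampleList F l).map (List.map f)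
  | [] => by simp [sampleList, PMF.pure_map]
  | a :: l => by
      rw [sampleList, sampleList_map F f l]
      simp only [sampleList, PMF.map, PMF.bind_bind, PMF.pure_bind, Function.comp_def,
        List.map_cons]

/-- Two passes with independent randomness merge into one: the second draw for an entry commutes
with the first draws for later entries. -/
theorem sampleList_bind {α β γ : Type} (F : α → PMF β) (G : β → PMF γ) : ∀ l : List α,
    (sampleList F l).bind (sampleList G) = sampleList (fun a => (F a).bind G) l
  | [] => by simp [sampleList]
  | a :: l => by
      simp only [sampleList, ← sampleList_bind F G l, PMF.bind_bind, PMF.pure_bind]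
      congr 1; funext b
      rw [PMF.bind_comm]

theorem sampleList_list_map {α β γ : Type} (F : β → PMF γ) (f : α → β) (l : List α) :
    sampleList F (l.map f) = sampleList (fun a => F (f a)) l := by
  induction l with
  | nil => rfl
  | cons a l ih => simp only [List.map_cons, sampleList, ih]

theorem sampleList_flatMap {α β γ δ : Type} (F : α → PMF β) (G : γ → PMF δ) (f : β → List δ)
    (k : α → List γ) (h : ∀ a, (F a).map f = sampleList G (k a)) : ∀ l : List α,
    (sampleList F l).map (List.flatMap f) = sampleList G (l.flatMap k)
  | [] => by simp [sampleList, PMF.pure_map]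
  | a :: l => by
      simp only [List.flatMap_cons, sampleList_append, ← sampleList_flatMap F G f k h l, ← h,
        sampleList, PMF.map, PMF.bind_bind, PMF.pure_bind, Function.comp_def]

/-- Sampling commutes with the traversal of a tree. -/
theorem Tree.map_splits_encrypt {n N : ℕ} (g : Z2 N) (h : Fin n → Z2 N) : ∀ t : Tree n ℕ,
    (t.encrypt g h).map Tree.splits =
      sampleList (fun a : Fin n × ℕ => HoEnc g (h a.1) a.2) t.label.splits
  | .leaf => by simp [Tree.encrypt, Tree.label, Tree.splits, sampleList, PMF.pure_map]
  | .node u m l r => by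
      simp only [Tree.encrypt, Tree.label, Tree.splits, sampleList, sampleList_append,
        ← Tree.map_splits_encrypt g h l, ← Tree.map_splits_encrypt g h r, PMF.map, PMF.bind_bind,
        PMF.pure_bind, Function.comp_def]

/-- Destruction is decided by the providers alone, so encryption may be postponed until after the
traversal; ciphertexts of surviving nodes are never read and integrate out. -/
theorem Tree.map_destroyed_encrypt {n N : ℕ} (g : Z2 N) (h : Fin n → Z2 N) (u : ℕ) :
    ∀ t : Tree n ℕ, (t.encrypt g h).map (Tree.destroyed u) =
      sampleList (sampleList fun a : Fin n × ℕ => HoEnc g (h a.1) a.2) (t.label.destroyed u)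
  | .leaf => by simp [Tree.encrypt, Tree.label, Tree.destroyed, sampleList, PMF.pure_map]
  | .node v m l r => by
      by_cases hv : (v : ℕ) = u
      · have := Tree.map_splits_encrypt g h (.node v m l r)
        simp only [Tree.label] at this
        simp only [Tree.label, Tree.destroyed, if_pos hv, sampleList, ← this]
        simp only [Tree.encrypt, Tree.destroyed, if_pos hv, PMF.map, PMF.bind_bind,
          PMF.pure_bind, Function.comp_def]
      · simp only [Tree.encrypt, Tree.label, Tree.destroyed, if_neg hv, sampleList_append,
          ← Tree.map_destroyed_encrypt g h u l, ← Tree.map_destroyed_encrypt g h u r, PMF.map,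
          PMF.bind_bind, PMF.pure_bind, Function.comp_def, PMF.bind_const]

theorem map_csMessages_encrypt {n N : ℕ} (g : Z2 N) (h : Fin n → Z2 N) (inp : RevocInput n) :
    (sampleList (Tree.encrypt g h) inp.forest).map (csMessages inp) =
      sampleList (fun m : Message (Fin n × ℕ) =>
        (sampleList (fun a : Fin n × ℕ => HoEnc g (h a.1) a.2) m.splits).map (Message.mk m.request))
        (plainMessages inp) := by
  unfold plainMessages csMessages
  split_ifs
  · have := sampleList_flatMap (Tree.encrypt g h)
      (sampleList fun a : Fin n × ℕ => HoEnc g (h a.1) a.2) (Tree.destroyed inp.revoked)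
      (fun t => t.label.destroyed inp.revoked) (Tree.map_destroyed_encrypt g h inp.revoked)
      inp.forest
    rw [sampleList_list_map]
    dsimp only
    rw [sampleList_map, List.flatMap_map, ← this, PMF.map_comp]
    rfl
  · simp only [sampleList, PMF.map, Function.comp_def, PMF.bind_const]

/-- A received ciphertext, the random value chosen for it and the answer. -/
def refreshData {N : ℕ} (c : Ciphertext N) (r : ℕ) : Data :=
  .pair c.toData (.pair (.num r) (Ciphertext.toData (HEncRef r c)))

/-- Put together what the computation service provider sees in one round. -/
def assembleRound (req t : Data) : Data :=
  .ofList [req, .ofList (t.toList.map Data.fst), .ofList (t.toList.map fun a => a.snd.fst),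
    .ofList (t.toList.map fun a => a.snd.snd)]

/-- Keeping each coin next to its ciphertext turns the round into a single kernel applied
independently to every entry. -/
theorem sampleList_refresh {N : ℕ} (μ : PMF ℕ) : ∀ cs : List (Ciphertext N),
    (sampleList (fun _ => μ) cs).map (fun rs => (cs, rs, List.zipWith HEncRef rs cs)) =
      (sampleList (fun c => μ.map fun r => (c, r)) cs).map fun ps =>
        (ps.map Prod.fst, ps.map Prod.snd, ps.map fun p => HEncRef p.2 p.1)
  | [] => by simp [sampleList, PMF.pure_map]
  | c :: cs => by
      have ih := fun r => congrArg (PMF.map fun q : List (Ciphertext N) × List ℕ ×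
        List (Ciphertext N) => (c :: q.1, r :: q.2.1, HEncRef r c :: q.2.2))
        (sampleList_refresh μ cs)
      simp only [PMF.map, PMF.bind_bind, PMF.pure_bind, Function.comp_def] at ih
      simp only [sampleList, PMF.map, PMF.bind_bind, PMF.pure_bind, Function.comp_def,
        List.zipWith_cons_cons, List.map_cons]
      congr 1; funext r
      exact ih r

theorem map_toData_ccRound {N : ℕ} (m : Message (Ciphertext N)) :
    (ccRound m).map Round.toData =
      (sampleList (fun c => (unif (Finset.range N)).map (refreshData c)) m.splits).map fun l =>
        assembleRound m.request (.ofList l) := by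
  have h := congrArg (PMF.map fun q : List (Ciphertext N) × List ℕ × List (Ciphertext N) =>
    Data.ofList [m.request, .ofList (q.1.map Ciphertext.toData), .ofList (q.2.1.map Data.num),
      .ofList (q.2.2.map Ciphertext.toData)]) (sampleList_refresh (unif (Finset.range N)) m.splits)
  have h2 : (fun c : Ciphertext N => (unif (Finset.range N)).map (refreshData c)) =
      fun c => ((unif (Finset.range N)).map fun r => (c, r)).map fun p => refreshData p.1 p.2 := by
    funext c
    rw [PMF.map_comp]
    rfl
  rw [h2, sampleList_map, PMF.map_comp, ccRound, PMF.map_comp]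
  rw [PMF.map_comp, PMF.map_comp] at h
  refine h.trans ?_
  congr 1
  funext ps
  simp [assembleRound, refreshData, Data.fst, Data.snd, Function.comp_def]

theorem mapCells_ofList {α : Type} (F : Data → PMF Data) (f : α → Data) : ∀ l : List α,
    mapCells (fun a _ => F a) (.ofList (l.map f)) =
      (sampleList (fun a => F (f a)) l).map Data.ofList
  | [] => by simp [sampleList, PMF.pure_map, mapCells, Data.ofList]
  | a :: l => by
      simp only [List.map_cons, Data.ofList, mapCells, mapCells_ofList F f l, sampleList, PMF.map,
        PMF.bind_bind, PMF.pure_bind, Function.comp_def]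

/-- The rounds of the computation service provider on a list of messages, if a received split, the
random value and the answer are supplied by `F`. The arguments of `F` are the messages that follow,
the item at hand, and the items that follow in the message. -/
def roundsData (F : Data → Data → Data → PMF Data) (t : Data) : PMF Data :=
  mapCells (fun m R => (mapCells (F R) m.snd).bind fun l => PMF.pure (assembleRound m.fst l)) t

/-- This puts the real view into the form used by the hybrids: one independent kernel per destroyed
split, acting on data. -/
theorem sampleList_ccRound_eq_roundsData {n N : ℕ} (g : Z2 N) (h : Fin n → Z2 N)
    (inp : RevocInput n) (F : Data → PMF Data)
    (hF : ∀ a : Fin n × ℕ, F (nodeData a) = (HoEnc g (h a.1) a.2).bind fun c =>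
      (unif (Finset.range N)).map (refreshData c)) :
    ((sampleList (Tree.encrypt g h) inp.forest).bind fun T =>
      (sampleList ccRound (csMessages inp T)).map fun rounds =>
        Data.ofList (rounds.map Round.toData)) =
      roundsData (fun _ a _ => F a) (.ofList ((plainMessages inp).map messageData)) := by
  have h1 : ∀ T : List (Tree n (Ciphertext N)),
      ((sampleList ccRound (csMessages inp T)).map fun rounds =>
        Data.ofList (rounds.map Round.toData)) =
      (sampleList (fun m => (ccRound m).map Round.toData) (csMessages inp T)).map Data.ofList := by
    intro T
    rw [sampleList_map, PMF.map_comp]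
    rfl
  simp only [h1, roundsData]
  rw [mapCells_ofList (fun m => (mapCells (fun a _ => F a) m.snd).bind fun l =>
    PMF.pure (assembleRound m.fst l)) messageData]
  have h2 := congrArg (fun μ => μ.bind fun ms =>
    (sampleList (fun m => (ccRound m).map Round.toData) ms).map Data.ofList)
    (map_csMessages_encrypt g h inp)
  simp only [PMF.bind_map, Function.comp_def] at h2
  rw [h2, ← PMF.map_bind, sampleList_bind]
  congr 2
  funext m
  rw [PMF.bind_map]
  simp only [messageData, Data.fst, Data.snd, nodesData, Function.comp_def, map_toData_ccRound]
  rw [mapCells_ofList, ← PMF.map_bind, sampleList_bind]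
  simp only [hF, PMF.map, PMF.bind_bind, PMF.pure_bind, Function.comp_def]

/-! ### Feasibility of samplers -/

theorem FeasibleNum.comp {f : Data → ℕ} {g : Data → Data} (hf : FeasibleNum f)
    (hg : FeasibleFun g) : FeasibleNum fun x => f (g x) := FeasibleFun.comp hf hg

theorem FeasibleFun.left {f : Data → Data} (hf : FeasibleFun f) : FeasibleFun fun y => f y.fst :=
  hf.comp FeasibleFun.id.fst

theorem FeasibleNum.left {f : Data → ℕ} (hf : FeasibleNum f) : FeasibleNum fun y => f y.fst :=
  hf.comp FeasibleFun.id.fst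

theorem FeasibleNum.snd_val : FeasibleNum fun y => y.snd.val := FeasibleFun.id.snd.val

theorem Feasible.bind_nat {μ : Data → PMF ℕ} {G : Data → ℕ → PMF Data}
    (hμ : Feasible fun x => (μ x).map Data.num) (hG : Feasible fun y => G y.fst y.snd.val) :
    Feasible fun x => (μ x).bind fun r => G x r :=
  (Feasible.bind (G := fun x a => G x a.val) hμ hG).of_eq fun x => by
    rw [PMF.bind_map]
    rfl

theorem Feasible.bind_pure {F : Data → PMF Data} {g : Data → Data → Data} (hF : Feasible F)
    (hg : FeasibleFun fun y => g y.fst y.snd) :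
    Feasible fun x => (F x).bind fun a => PMF.pure (g x a) :=
  Feasible.bind (G := fun x a => PMF.pure (g x a)) hF hg

theorem FeasibleNum.ite {p : Data → Prop} [DecidablePred p] {f g : Data → ℕ}
    (hp : FeasiblePred p) (hf : FeasibleNum f) (hg : FeasibleNum g) :
    FeasibleNum fun x => if p x then f x else g x :=
  FeasibleFun.of_eq (FeasibleFun.ite hp hf.num hg.num) fun x => by
    by_cases h : p x <;> simp only [h, if_true, if_false]

theorem ofList_map_iid_succ {n : ℕ} (μ : PMF ℕ) (φ : Fin (n + 1) → ℕ → Data) :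
    ((iid μ (n + 1)).map fun f => Data.ofList (List.ofFn fun v => φ v (f v))) =
      μ.bind fun a => ((iid μ n).map fun f =>
        Data.ofList (List.ofFn fun v : Fin n => φ v.succ (f v))).bind
          fun l => PMF.pure (.pair (φ 0 a) l) := by
  simp only [iid, PMF.map, PMF.bind_bind, PMF.pure_bind, Function.comp_def, List.ofFn_succ,
    Fin.cons_zero, Fin.cons_succ, Data.ofList]

theorem Feasible.bind_cons {μ : Data → PMF ℕ} {L : Data → PMF Data} {φ : ℕ → Data → Data}
    (hμ : Feasible fun x => (μ x).map Data.num) (hL : Feasible L)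
    (hφ : FeasibleFun fun y => φ y.snd.val y.fst) :
    Feasible fun x => (μ x).bind fun a => (L x).bind fun l => PMF.pure (.pair (φ a x) l) := by
  refine Feasible.bind_nat (G := fun x a => (L x).bind fun l => PMF.pure (.pair (φ a x) l)) hμ ?_
  exact Feasible.bind_pure (F := fun y => L y.fst) (g := fun y l => .pair (φ y.snd.val y.fst) l)
    (Feasible.comp_fun (F := L) hL FeasibleFun.id.fst) (hφ.left.pair FeasibleFun.id.snd)

theorem Feasible.map_iid {μ : Data → PMF ℕ} (hμ : Feasible fun x => (μ x).map Data.num) (n : ℕ)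
    {φ : Fin n → ℕ → Data → Data} (hφ : ∀ v, FeasibleFun fun y => φ v y.snd.val y.fst) :
    Feasible fun x => (iid (μ x) n).map fun f => .ofList (List.ofFn fun v => φ v (f v) x) := by
  induction n with
  | zero =>
      have h : FeasibleFun fun _ => .num 0 := .const _
      refine Feasible.of_eq h fun x => ?_
      simp [iid, PMF.pure_map, Data.ofList]
  | succ n ih =>
      exact (Feasible.bind_cons hμ (ih fun v => hφ v.succ) (hφ 0)).of_eq fun x =>
        (ofList_map_iid_succ (μ x) fun v a => φ v a x).symm

/-- The distribution of exponents, in a form that is convenient for sampling. -/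
def expDist (N : ℕ) : PMF ℕ := (unif (Finset.range (N / 4))).bind fun r => PMF.pure (r + 1)

theorem Feasible.expDist {N : Data → ℕ} (hN : FeasibleNum N) :
    Feasible fun x => (RevFRF.expDist (N x)).map Data.num := by
  refine (Feasible.bind_unif (G := fun _ r => PMF.pure (.num (r + 1))) (hN.div (.const 4))
    (FeasibleNum.snd_val.add (.const 1)).num).of_eq fun x => ?_
  rw [RevFRF.expDist, PMF.map_bind]
  simp only [PMF.pure_map]

/-- The refresh of the ciphertext `(c₁, c₂)`. -/
def refreshDist (N c₁ c₂ : ℕ) : PMF Data :=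
  (unif (Finset.range N)).bind fun r => PMF.pure (.pair (.pair (.num c₁) (.num c₂))
    (.pair (.num r) (.pair (.num (c₁ * (c₂ ^ r % modulus N) % modulus N)) (.num c₂))))

theorem FeasibleNum.modulus {N : Data → ℕ} (hN : FeasibleNum N) :
    FeasibleNum fun x => RevFRF.modulus (N x) :=
  (hN.mul hN).add ((FeasibleNum.const 1).sub (hN.mul hN))

theorem Feasible.refreshDist {N c₁ c₂ : Data → ℕ} (hN : FeasibleNum N) (h₁ : FeasibleNum c₁)
    (h₂ : FeasibleNum c₂) : Feasible fun x => RevFRF.refreshDist (N x) (c₁ x) (c₂ x) := by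
  unfold RevFRF.refreshDist
  refine Feasible.bind_unif (G := fun x r => PMF.pure (.pair (.pair (.num (c₁ x)) (.num (c₂ x)))
    (.pair (.num r) (.pair (.num (c₁ x * (c₂ x ^ r % RevFRF.modulus (N x)) %
      RevFRF.modulus (N x))) (.num (c₂ x)))))) hN ?_
  exact (h₁.left.num.pair h₂.left.num).pair (FeasibleNum.snd_val.num.pair
    (((h₁.left.mul (h₂.left.pow_mod .snd_val hN.left)).mod hN.modulus.left).num.pair h₂.left.num))

/-- What happens to a split `m` encrypted under the public key `h`. -/
def realNode (N g h m : ℕ) : PMF Data :=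
  (expDist N).bind fun r =>
    refreshDist N (h ^ r % modulus N * (1 + m * N) % modulus N) (g ^ r % modulus N)

theorem Feasible.realNode {N g h m : Data → ℕ} (hN : FeasibleNum N) (hg : FeasibleNum g)
    (hh : FeasibleNum h) (hm : FeasibleNum m) :
    Feasible fun x => RevFRF.realNode (N x) (g x) (h x) (m x) := by
  unfold RevFRF.realNode
  refine Feasible.bind_nat (G := fun x r => RevFRF.refreshDist (N x)
    (h x ^ r % RevFRF.modulus (N x) * (1 + m x * N x) % RevFRF.modulus (N x))
    (g x ^ r % RevFRF.modulus (N x))) (Feasible.expDist hN) ?_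
  exact Feasible.refreshDist hN.left (((hh.left.pow_mod .snd_val hN.left).mul
    ((FeasibleNum.const 1).add (hm.mul hN).left)).mod hN.modulus.left)
    (hg.left.pow_mod .snd_val hN.left)

/-- The element `b²` or `- b²`. -/
def signedSq (N s b : ℕ) : ℕ :=
  if s = 0 then b * b % modulus N else (modulus N - b * b % modulus N) % modulus N

/-- The same for a simulated ciphertext. -/
def idealNode (N g : ℕ) : PMF Data :=
  (unif (Finset.range 2)).bind fun s => (unif (Finset.range (N * N))).bind fun b =>
    (expDist N).bind fun r => refreshDist N (signedSq N s b) (g ^ r % modulus N)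

theorem Feasible.idealNode {N g : Data → ℕ} (hN : FeasibleNum N) (hg : FeasibleNum g) :
    Feasible fun x => RevFRF.idealNode (N x) (g x) := by
  unfold RevFRF.idealNode
  refine Feasible.bind_unif (G := fun x s => (unif (Finset.range (N x * N x))).bind fun b =>
    (RevFRF.expDist (N x)).bind fun r => RevFRF.refreshDist (N x) (signedSq (N x) s b)
      (g x ^ r % RevFRF.modulus (N x))) (.const 2) ?_
  refine Feasible.bind_unif (G := fun y b => (RevFRF.expDist (N y.fst)).bind fun r =>
    RevFRF.refreshDist (N y.fst) (signedSq (N y.fst) y.snd.val b)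
      (g y.fst ^ r % RevFRF.modulus (N y.fst))) (hN.mul hN).left ?_
  refine Feasible.bind_nat (G := fun y r =>
    RevFRF.refreshDist (N y.fst.fst) (signedSq (N y.fst.fst) y.fst.snd.val y.snd.val)
      (g y.fst.fst ^ r % RevFRF.modulus (N y.fst.fst))) (Feasible.expDist hN.left.left) ?_
  refine Feasible.refreshDist hN.left.left.left ?_
    (hg.left.left.left.pow_mod .snd_val hN.left.left.left)
  have hb : FeasibleNum fun y => y.fst.snd.val * y.fst.snd.val :=
    FeasibleNum.snd_val.left.mul FeasibleNum.snd_val.left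
  have hM := hN.modulus.left.left.left
  exact FeasibleNum.ite (FeasiblePred.eq FeasibleNum.snd_val.left.left (.const 0))
    (hb.mod hM) ((hM.sub (hb.mod hM)).mod hM)

/-- The same for the ciphertext of `m` made from a Diffie-Hellman challenge. -/
def challengeNode (N Y Z m : ℕ) : PMF Data :=
  refreshDist N (Z * (1 + m * N) % modulus N) Y

theorem Feasible.challengeNode {N Y Z m : Data → ℕ} (hN : FeasibleNum N) (hY : FeasibleNum Y)
    (hZ : FeasibleNum Z) (hm : FeasibleNum m) :
    Feasible fun x => RevFRF.challengeNode (N x) (Y x) (Z x) (m x) :=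
  Feasible.refreshDist hN ((hZ.mul ((FeasibleNum.const 1).add (hm.mul hN))).mod hN.modulus) hY

/-- The element of a list at a position below `n`. -/
def nth : (n : ℕ) → Data → ℕ → ℕ
  | 0, _, _ => 0
  | n + 1, l, v => if v = 0 then l.fst.val else nth n l.snd (v - 1)

theorem nth_ofFn : ∀ {n : ℕ} (f : Fin n → ℕ) (v : Fin n),
    nth n (.ofList (List.ofFn fun i => .num (f i))) v = f v
  | 0, _, v => v.elim0
  | n + 1, f, v => by
      rw [List.ofFn_succ, Data.ofList, nth]
      refine Fin.cases ?_ (fun i => ?_) v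
      · rfl
      · simp only [Fin.val_succ, Nat.add_sub_cancel, Data.snd]
        rw [if_neg (by omega), nth_ofFn (fun i => f i.succ) i]

theorem FeasibleNum.nth : ∀ (n : ℕ) {l : Data → Data} {v : Data → ℕ} (_ : FeasibleFun l)
    (_ : FeasibleNum v), FeasibleNum fun x => RevFRF.nth n (l x) (v x)
  | 0, _, _, _, _ => .const 0
  | n + 1, l, v, hl, hv => by
      refine FeasibleFun.of_eq (FeasibleFun.ite (FeasiblePred.eq hv (.const 0)) hl.fst.val.num
        (FeasibleNum.nth n hl.snd (hv.sub (.const 1))).num) fun x => ?_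
      simp only [RevFRF.nth]
      split_ifs <;> rfl

/-- The hybrid treatment of an item: the splits of the participants before `i`, and those of `i` with
less than `j` data behind them, are simulated; the challenge is used for the split of `i` with
exactly `j` data behind it; all other splits are treated as in the protocol. -/
def hybridNode (n i N g j Y Z : ℕ) (hs R a b : Data) : PMF Data :=
  if a.fst.val < i ∨ (a.fst.val = i ∧ b.size + R.size < j) then idealNode N g
  else if a.fst.val = i ∧ b.size + R.size = j then challengeNode N Y Z a.snd.val
  else realNode N g (nth n hs a.fst.val) a.snd.val

theorem Feasible.hybridNode (n i : ℕ) {N g j Y Z : Data → ℕ} {hs R a b : Data → Data}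
    (hN : FeasibleNum N) (hg : FeasibleNum g) (hj : FeasibleNum j) (hY : FeasibleNum Y)
    (hZ : FeasibleNum Z) (hhs : FeasibleFun hs) (hR : FeasibleFun R) (ha : FeasibleFun a)
    (hb : FeasibleFun b) : Feasible fun x =>
      RevFRF.hybridNode n i (N x) (g x) (j x) (Y x) (Z x) (hs x) (R x) (a x) (b x) := by
  have hs := (FeasibleNum.size hb).add (FeasibleNum.size hR)
  refine Feasible.ite ?_ (Feasible.idealNode hN hg) (Feasible.ite ?_
    (Feasible.challengeNode hN hY hZ ha.snd.val)
    (Feasible.realNode hN hg (FeasibleNum.nth n hhs ha.fst.val) ha.snd.val))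
  · exact (FeasiblePred.lt ha.fst.val (.const i)).or
      ((FeasiblePred.eq ha.fst.val (.const i)).and (FeasiblePred.lt hs hj))
  · exact (FeasiblePred.eq ha.fst.val (.const i)).and (FeasiblePred.eq hs hj)

theorem FeasibleFun.assembleRound {r t : Data → Data} (hr : FeasibleFun r) (ht : FeasibleFun t) :
    FeasibleFun fun x => RevFRF.assembleRound (r x) (t x) :=
  hr.pair <| FeasibleFun.pair (FeasibleFun.map (F := fun _ a => a.fst) FeasibleFun.id.fst.fst ht) <|
    FeasibleFun.pair (FeasibleFun.map (F := fun _ a => a.snd.fst) FeasibleFun.id.fst.snd.fst ht) <|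
    FeasibleFun.pair (FeasibleFun.map (F := fun _ a => a.snd.snd) FeasibleFun.id.fst.snd.snd ht) <|
    .const (.num 0)

theorem Feasible.roundsData {F : Data → Data → Data → Data → PMF Data} {f : Data → Data}
    (hF : Feasible fun y => F y.fst y.snd.fst y.snd.snd.fst y.snd.snd.snd) (hf : FeasibleFun f) :
    Feasible fun x => RevFRF.roundsData (F x) (f x) := by
  have h := FeasibleFun.id
  refine Feasible.mapCells' (K := fun x m R => (RevFRF.mapCells (F x R) m.snd).bind fun l =>
    PMF.pure (RevFRF.assembleRound m.fst l)) ?_ hf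
  refine Feasible.bind_pure (F := fun y => RevFRF.mapCells (F y.snd y.fst.snd) y.fst.fst.snd)
    (g := fun y l => RevFRF.assembleRound y.fst.fst.fst l) ?_
    (FeasibleFun.assembleRound h.fst.fst.fst.fst h.snd)
  refine Feasible.mapCells' (K := fun y => F y.snd y.fst.snd) ?_ h.fst.fst.snd
  exact hF.comp_fun (h.snd.snd.pair (h.snd.fst.snd.pair (h.fst.fst.pair h.fst.snd)))

/-! ### The simulator and the reductions -/

/-- The simulator, as a function of the local data and the leakage. -/
def simDist (x : Data) : PMF Data :=
  roundsData (fun _ _ _ => idealNode x.fst.snd.fst.val x.fst.snd.snd.fst.val) x.snd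

theorem feasible_simDist : Feasible simDist := by
  have h := FeasibleFun.id
  exact Feasible.roundsData
    (F := fun x _ _ _ => RevFRF.idealNode x.fst.snd.fst.val x.fst.snd.snd.fst.val)
    (Feasible.idealNode h.fst.fst.snd.fst.val h.fst.fst.snd.snd.fst.val) h.snd

/-- The labelled messages of the center server, as a function of the output of the environment. -/
def messagesData (n : ℕ) (d : Data) : Data :=
  .ofList ((plainMessages (RevocInput.ofData n d)).map messageData)

/-- Issue public keys, the key of participant `i` being `X`. -/
def keysWith (n i N g : ℕ) (X : Data) : PMF Data :=
  (iid (expDist N) n).map fun sk => .ofList (List.ofFn fun v : Fin n =>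
    if (v : ℕ) = i then X else .num (g ^ sk v % modulus N))

theorem Feasible.keysWith (n i : ℕ) {N g : Data → ℕ} {X : Data → Data} (hN : FeasibleNum N)
    (hg : FeasibleNum g) (hX : FeasibleFun X) :
    Feasible fun x => RevFRF.keysWith n i (N x) (g x) (X x) := by
  refine Feasible.map_iid (n := n) (φ := fun v s x => if (v : ℕ) = i then X x else
    .num (g x ^ s % RevFRF.modulus (N x))) (hμ := Feasible.expDist hN) fun v => ?_
  by_cases hv : (v : ℕ) = i
  · simpa only [hv, if_true] using hX.left
  · simpa only [hv, if_false] using (hg.left.pow_mod .snd_val hN.left).num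

/-- Run the environment on the given keys and treat the destroyed splits in the hybrid way. -/
def runHybrid (n : ℕ) (env : Prog) (k N g hs : Data)
    (F : Data → Data → Data → PMF Data) : PMF Data :=
  -- A substitute for the share: the true range `λ N²` is unknown without the factorization of `N`.
  (unif (Finset.range (N.val / 2 * (N.val * N.val)))).bind fun l2 =>
    (env.out (.ofList [k, N, g, hs, .num l2])).bind fun e =>
      (roundsData F (messagesData n e.snd)).bind fun t =>
        PMF.pure (.pair (.ofList [k, N, g, hs, .num l2]) (.pair e t))

theorem Feasible.runHybrid (n : ℕ) {env : Prog} (henv : env.PPT) {k N g hs : Data → Data}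
    {F : Data → Data → Data → Data → PMF Data} (hk : FeasibleFun k) (hN : FeasibleFun N)
    (hg : FeasibleFun g) (hhs : FeasibleFun hs)
    (hF : Feasible fun y => F y.fst y.snd.fst y.snd.snd.fst y.snd.snd.snd) :
    Feasible fun x => RevFRF.runHybrid n env (k x) (N x) (g x) (hs x) (F x) := by
  have h := FeasibleFun.id
  let loc : Data → ℕ → Data := fun x l2 => .ofList [k x, N x, g x, hs x, .num l2]
  have hloc : FeasibleFun fun y => loc y.fst y.snd.val :=
    hk.left.pair (hN.left.pair (hg.left.pair (hhs.left.pair (h.snd.val.num.pair (.const _)))))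
  refine Feasible.bind_unif (G := fun x l2 => (env.out (loc x l2)).bind fun e =>
    (RevFRF.roundsData (F x) (messagesData n e.snd)).bind fun t =>
      PMF.pure (.pair (loc x l2) (.pair e t)))
    ((hN.val.div (.const 2)).mul (hN.val.mul hN.val)) ?_
  refine Feasible.bind (F := fun y => env.out (loc y.fst y.snd.val)) (G := fun y e =>
    (RevFRF.roundsData (F y.fst) (messagesData n e.snd)).bind fun t =>
      PMF.pure (.pair (loc y.fst y.snd.val) (.pair e t)))
    (henv.feasible.comp_fun hloc) ?_
  refine Feasible.bind_pure
    (F := fun y => RevFRF.roundsData (F y.fst.fst) (messagesData n y.snd.snd))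
    (g := fun y t => .pair (loc y.fst.fst y.fst.snd.val) (.pair y.snd t)) ?_
    (hloc.left.left.pair (h.fst.snd.pair h.snd))
  exact Feasible.roundsData (F := fun y => F y.fst.fst)
    (hF.comp_fun (h.fst.fst.fst.pair h.snd))
    ((FeasibleFun.plainMessages n).comp h.snd.snd)

/-- The reduction of participant `i`: on a Diffie-Hellman challenge, run the environment with
challenge keys, with a random hybrid position below `Q`. -/
def reduction (n i : ℕ) (Q : Polynomial ℕ) (env : Prog) (x : Data) : PMF Data :=
  -- On a challenge, `x.fst` is the security parameter `k` in unary, of size `2 * k + 1`.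
  (unif (Finset.range (Q.eval x.fst.size))).bind fun j =>
    (keysWith n i x.snd.fst.val x.snd.snd.fst.val x.snd.snd.snd.fst).bind fun hs =>
      runHybrid n env x.fst x.snd.fst x.snd.snd.fst hs (hybridNode n i x.snd.fst.val
        x.snd.snd.fst.val j x.snd.snd.snd.snd.fst.val x.snd.snd.snd.snd.snd.fst.val hs)

theorem feasible_reduction (n i : ℕ) (Q : Polynomial ℕ) {env : Prog} (henv : env.PPT) :
    Feasible (reduction n i Q env) := by
  have h := FeasibleFun.id
  refine Feasible.bind_unif (G := fun x j => (keysWith n i x.snd.fst.val x.snd.snd.fst.val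
    x.snd.snd.snd.fst).bind fun hs => runHybrid n env x.fst x.snd.fst x.snd.snd.fst hs
      (hybridNode n i x.snd.fst.val x.snd.snd.fst.val j x.snd.snd.snd.snd.fst.val
        x.snd.snd.snd.snd.snd.fst.val hs)) (FeasibleNum.natPoly Q (FeasibleNum.size h.fst)) ?_
  refine Feasible.bind (F := fun y => keysWith n i y.fst.snd.fst.val y.fst.snd.snd.fst.val
    y.fst.snd.snd.snd.fst) (G := fun y hs => runHybrid n env y.fst.fst y.fst.snd.fst
      y.fst.snd.snd.fst hs (hybridNode n i y.fst.snd.fst.val y.fst.snd.snd.fst.val y.snd.val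
        y.fst.snd.snd.snd.snd.fst.val y.fst.snd.snd.snd.snd.snd.fst.val hs))
    (Feasible.keysWith n i h.fst.snd.fst.val h.fst.snd.snd.fst.val h.fst.snd.snd.snd.fst) ?_
  refine Feasible.runHybrid n henv h.fst.fst.fst h.fst.fst.snd.fst h.fst.fst.snd.snd.fst h.snd
    (F := fun y => hybridNode n i y.fst.fst.snd.fst.val y.fst.fst.snd.snd.fst.val y.fst.snd.val
      y.fst.fst.snd.snd.snd.snd.fst.val y.fst.fst.snd.snd.snd.snd.snd.fst.val y.snd) ?_
  exact Feasible.hybridNode n i h.fst.fst.fst.snd.fst.val h.fst.fst.fst.snd.snd.fst.val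
    h.fst.fst.snd.val h.fst.fst.fst.snd.snd.snd.snd.fst.val
    h.fst.fst.fst.snd.snd.snd.snd.snd.fst.val h.fst.snd h.snd.fst h.snd.snd.fst h.snd.snd.snd

/-! ### Uniform distributions -/

theorem lt_of_mem_support_unif {n r : ℕ} (hn : 0 < n)
    (h : r ∈ (unif (Finset.range n)).support) : r < n := by
  rw [unif, dif_pos (Finset.nonempty_range_iff.2 hn.ne'),
    PMF.mem_support_uniformOfFinset_iff, Finset.mem_range] at h
  exact h

theorem bind_congr_support {α β : Type} (μ : PMF α) {f g : α → PMF β}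
    (h : ∀ a ∈ μ.support, f a = g a) : μ.bind f = μ.bind g := by
  ext b
  simp only [PMF.bind_apply]
  refine tsum_congr fun a => ?_
  by_cases ha : a ∈ μ.support
  · rw [h a ha]
  · rw [(PMF.apply_eq_zero_iff μ a).2 ha, zero_mul, zero_mul]

open Classical in
theorem map_unif_of_injOn {α : Type} {s : Finset ℕ} (hs : s.Nonempty) {f : ℕ → α}
    (hf : Set.InjOn f s) :
    (unif s).map f = PMF.uniformOfFinset (s.image f) (hs.image f) := by
  ext b
  rw [unif, dif_pos hs, PMF.map_apply, PMF.uniformOfFinset_apply]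
  split_ifs with hb
  · obtain ⟨a, ha, rfl⟩ := Finset.mem_image.1 hb
    rw [tsum_eq_single a]
    · rw [if_pos rfl, PMF.uniformOfFinset_apply, if_pos ha, Finset.card_image_of_injOn hf]
    · intro a' ha'
      rw [PMF.uniformOfFinset_apply]
      split_ifs with h1 h2
      · exact absurd (hf h2 ha h1.symm) ha'
      · rfl
      · rfl
  · rw [ENNReal.tsum_eq_zero]
    intro a
    rw [PMF.uniformOfFinset_apply]
    split_ifs with h1 h2
    · exact absurd (Finset.mem_image.2 ⟨a, h2, h1.symm⟩) hb
    · rfl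
    · rfl

/-- For `N < 4` the two defaults differ: the left side is the point mass at `0`, the right side at
`1`. -/
theorem sampleExp_eq {N : ℕ} (hN : 4 ≤ N) : sampleExp N = expDist N := by
  classical
  have h0 : (Finset.range (N / 4)).Nonempty := Finset.nonempty_range_iff.2 (by omega)
  have h1 : (Finset.Icc 1 (N / 4)).Nonempty := Finset.nonempty_Icc.2 (by omega)
  have h2 : expDist N = (unif (Finset.range (N / 4))).map fun r => r + 1 := rfl
  rw [h2, map_unif_of_injOn h0 (fun a _ b _ h => by simpa using h), sampleExp, unif, dif_pos h1]
  congr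
  ext r
  simp only [Finset.mem_Icc, Finset.mem_image, Finset.mem_range]
  constructor
  · rintro ⟨h, h'⟩
    exact ⟨r - 1, by omega, by omega⟩
  · rintro ⟨a, h, rfl⟩
    omega

/-- Multiplication by a unit preserves the uniform distribution on `ℤ / M`. -/
theorem map_unif_range_unit_mul {M : ℕ} [NeZero M] (u : (ZMod M)ˣ) :
    (unif (Finset.range M)).map (fun b : ℕ => (u : ZMod M) * (b : ZMod M)) =
      (unif (Finset.range M)).map fun b : ℕ => (b : ZMod M) := by
  classical
  have h0 : (Finset.range M).Nonempty := Finset.nonempty_range_iff.2 (NeZero.ne M)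
  have hinj : Set.InjOn (fun b : ℕ => (b : ZMod M)) (Finset.range M) := by
    intro a ha b hb h
    have h' := congrArg ZMod.val h
    simp only [Finset.coe_range, Set.mem_Iio] at ha hb
    simpa [ZMod.val_natCast, Nat.mod_eq_of_lt ha, Nat.mod_eq_of_lt hb] using h'
  have hinj' : Set.InjOn (fun b : ℕ => (u : ZMod M) * (b : ZMod M)) (Finset.range M) :=
    fun a ha b hb h => hinj ha hb (u.mul_right_inj.1 h)
  have key : ∀ f : ℕ → ZMod M, Set.InjOn f (Finset.range M) →
      (Finset.range M).image f = Finset.univ := fun f hf =>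
    Finset.eq_univ_of_card _ (by rw [Finset.card_image_of_injOn hf, Finset.card_range, ZMod.card])
  rw [map_unif_of_injOn h0 hinj, map_unif_of_injOn h0 hinj']
  congr 1
  convert (key _ hinj').trans (key _ hinj).symm

/-- In an odd modulus `N`, the element `1 + m N` of `ℤ / N²` is the square of a unit. -/
theorem exists_unit_sq_eq {N : ℕ} (hN : Odd N) (m : ℕ) :
    ∃ u : (Z2 N)ˣ, (u : Z2 N) ^ 2 = 1 + (m : Z2 N) * (N : Z2 N) := by
  have hNN : (N : Z2 N) * (N : Z2 N) = 0 := by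
    rw [← Nat.cast_mul, ← sq]
    exact ZMod.natCast_self _
  have h2 : ((2 : ℕ) : Z2 N) * ((2 : ℕ) : Z2 N)⁻¹ = 1 :=
    ZMod.coe_mul_inv_eq_one 2 ((Nat.coprime_two_left.2 hN).pow_right 2)
  push_cast at h2
  -- The root is `1 + c N` with `c = m / 2`, and its inverse is `1 - c N`, because `N * N = 0` in `ℤ
  -- / N²`.
  set c : Z2 N := (m : Z2 N) * (2 : Z2 N)⁻¹ with hc
  refine ⟨⟨1 + c * N, 1 - c * N, ?_, ?_⟩, ?_⟩
  · linear_combination (-c ^ 2) * hNN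
  · linear_combination (-c ^ 2) * hNN
  · simp only
    linear_combination c ^ 2 * hNN + (m : Z2 N) * N * h2

/-- Here the plaintext disappears: `± b² u² = ± (b u)²`, and `b u` is uniform with `b`. As `b`
ranges over the whole ring, units or not, the equality is exact. -/
theorem sampleElt_bind_mul {N : ℕ} (hN : Odd N) (m : ℕ) {β : Type} (Φ : Z2 N → PMF β) :
    ((sampleElt N).bind fun Z => Φ (Z * (1 + (m : Z2 N) * (N : Z2 N)))) = (sampleElt N).bind Φ := by
  obtain ⟨u, hu⟩ := exists_unit_sq_eq hN m
  have : NeZero (N ^ 2) := ⟨pow_ne_zero 2 hN.pos.ne'⟩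
  have key := map_unif_range_unit_mul (M := N ^ 2) u
  simp only [sampleElt, PMF.bind_bind, PMF.bind_map, Function.comp_def]
  congr 1; funext s
  have h := congrArg (fun μ => μ.bind fun b : Z2 N => Φ ((-1) ^ s * b ^ 2)) key
  simp only [PMF.bind_map, Function.comp_def] at h
  rw [← h]
  congr 1; funext b
  congr 1
  rw [← hu]
  ring

/-! ### Numbers and residues -/

theorem val_natCast_modulus {N : ℕ} (hN : 0 < N) (a : ℕ) : ((a : Z2 N)).val = a % modulus N := by
  rw [modulus_eq hN, ZMod.val_natCast]

theorem cast_val {N : ℕ} (hN : 0 < N) (a : Z2 N) : ((a.val : ℕ) : Z2 N) = a := by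
  have : NeZero (N ^ 2) := ⟨pow_ne_zero 2 hN.ne'⟩
  exact ZMod.natCast_zmod_val a

theorem val_pow_eq {N : ℕ} (hN : 0 < N) (a : Z2 N) (r : ℕ) :
    (a ^ r).val = a.val ^ r % modulus N := by
  rw [← val_natCast_modulus hN, Nat.cast_pow, cast_val hN]

theorem val_mul_eq {N : ℕ} (hN : 0 < N) (a b : Z2 N) :
    (a * b).val = a.val * b.val % modulus N := by
  rw [← val_natCast_modulus hN, Nat.cast_mul, cast_val hN, cast_val hN]

theorem val_mul_one_add {N : ℕ} (hN : 0 < N) (a : Z2 N) (m : ℕ) :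
    (a * (1 + (m : Z2 N) * (N : Z2 N))).val = a.val * (1 + m * N) % modulus N := by
  rw [← val_natCast_modulus hN]
  push_cast
  rw [cast_val hN]

theorem refreshDist_val {N : ℕ} (hN : 0 < N) (c : Ciphertext N) :
    refreshDist N c.1.val c.2.val = (unif (Finset.range N)).map (refreshData c) := by
  simp only [refreshDist, PMF.map, refreshData, Ciphertext.toData, HEncRef, val_mul_eq hN,
    val_pow_eq hN, Function.comp_def]

theorem realNode_val {N : ℕ} (hN : 4 ≤ N) (g h : Z2 N) (m : ℕ) :
    realNode N g.val h.val m = (HoEnc g h m).bind fun c => refreshDist N c.1.val c.2.val := by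
  have h0 : 0 < N := by omega
  simp only [realNode, HoEnc, PMF.bind_map, Function.comp_def, sampleExp_eq hN,
    val_mul_one_add h0, val_pow_eq h0]

theorem signedSq_val {N s : ℕ} (hN : 0 < N) (hs : s < 2) (b : ℕ) :
    ((-1) ^ s * (b : Z2 N) ^ 2).val = signedSq N s b := by
  have : NeZero (N ^ 2) := ⟨pow_ne_zero 2 hN.ne'⟩
  have h1 : ((b : Z2 N) ^ 2).val = b * b % modulus N := by
    rw [pow_two (b : Z2 N), ← Nat.cast_mul, val_natCast_modulus hN]
  have h3 : s = 0 ∨ s = 1 := by omega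
  rcases h3 with rfl | rfl
  · rw [pow_zero, one_mul, h1, signedSq, if_pos rfl]
  · rw [pow_one, neg_one_mul, ZMod.neg_val', h1, signedSq, if_neg one_ne_zero, modulus_eq hN]

theorem idealNode_val {N : ℕ} (hN : 4 ≤ N) (g : Z2 N) :
    idealNode N g.val = (sampleElt N).bind fun Z => (sampleExp N).bind fun r =>
      refreshDist N Z.val (g ^ r).val := by
  have h0 : 0 < N := by omega
  simp only [idealNode, sampleElt, PMF.bind_bind, PMF.bind_map, Function.comp_def,
    sampleExp_eq hN, val_pow_eq h0]
  refine bind_congr_support _ fun s hs => ?_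
  have hs := lt_of_mem_support_unif (by norm_num) hs
  simp only [signedSq_val h0 hs, sq N]

/-- A real challenge is an encryption with randomness `y`, since `(g ^ x) ^ y = g ^ (x * y)`. -/
theorem challengeNode_real {N : ℕ} (hN : 4 ≤ N) (g : Z2 N) (x m : ℕ) :
    ((sampleExp N).bind fun y => challengeNode N (g ^ y).val (g ^ (x * y)).val m) =
      realNode N g.val (g ^ x).val m := by
  have h0 : 0 < N := by omega
  simp only [realNode_val hN, HoEnc, PMF.bind_map, Function.comp_def, challengeNode,
    val_mul_one_add h0, pow_mul]

theorem challengeNode_random {N : ℕ} (hN : 4 ≤ N) (hodd : Odd N) (g : Z2 N) (m : ℕ) :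
    ((sampleExp N).bind fun y => (sampleElt N).bind fun Z =>
      challengeNode N (g ^ y).val Z.val m) = idealNode N g.val := by
  have h0 : 0 < N := by omega
  rw [idealNode_val hN, PMF.bind_comm (sampleElt N)]
  congr 1; funext y
  simp only [challengeNode, ← val_mul_one_add h0]
  exact sampleElt_bind_mul hodd m fun Z => refreshDist N Z.val (g ^ y).val

/-! ### Moving a challenge to the position where it is used -/

theorem mapCells_congr {F G : Data → Data → PMF Data} : ∀ t : Data,
    (∀ a b, (Data.pair a b).size ≤ t.size → F a b = G a b) → mapCells F t = mapCells G t
  | .num _, _ => rfl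
  | .pair a b, h => by
      rw [mapCells, mapCells, h a b le_rfl, mapCells_congr b fun a' b' h' => h a' b' (by
        simp only [Data.size] at *; omega)]

/-- The intervals from `b.size` to the size of `pair a b` are disjoint for the successive cells of a
list, so at most one cell depends on `y` and the sampling of `y` can be moved into it. -/
theorem bind_mapCells {γ : Type} (μ : PMF γ) (F : γ → Data → Data → PMF Data) (j : ℕ)
    (hF : ∀ a b, ¬ (b.size ≤ j ∧ j < (Data.pair a b).size) → ∀ y y', F y a b = F y' a b) :
    ∀ t, (μ.bind fun y => mapCells (F y) t) = mapCells (fun a b => μ.bind fun y => F y a b) t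
  | .num _ => by simp only [mapCells, PMF.bind_const]
  | .pair a b => by
      have hconst : ∀ a b, ¬ (b.size ≤ j ∧ j < (Data.pair a b).size) → ∀ y,
          F y a b = μ.bind fun y => F y a b := by
        intro a b h y
        conv_rhs => rw [show (fun y => F y a b) = fun _ => F y a b from
          funext fun y' => hF a b h y' y]
        rw [PMF.bind_const]
      -- Either all later cells have size at most `j` and ignore `y`, or the present cell ignores
      -- it.
      by_cases hj : b.size ≤ j
      · have h : ∀ y, mapCells (F y) b = mapCells (fun a b => μ.bind fun y => F y a b) b :=
          fun y => mapCells_congr b fun a' b' h' => hconst a' b' (by omega) y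
        simp only [mapCells, h, PMF.bind_bind]
      · simp only [mapCells, ← bind_mapCells μ F j hF b]
        conv_lhs =>
          arg 2; ext y
          rw [hconst a b (fun h => hj h.1) y]
        rw [PMF.bind_comm μ]
        simp only [PMF.bind_bind]

/-- The positions of the splits of a message `m` followed by `R` lie between `R.size` and the size
of `pair m R`. Hence `j` singles out at most one message, and `j - R.size` at most one split in it.
-/
theorem bind_roundsData {γ : Type} (μ : PMF γ) (F : γ → Data → Data → Data → PMF Data) (j : ℕ)
    (hF : ∀ R a b, b.size + R.size ≠ j → ∀ y y', F y R a b = F y' R a b) (t : Data) :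
    (μ.bind fun y => roundsData (F y) t) =
      roundsData (fun R a b => μ.bind fun y => F y R a b) t := by
  unfold roundsData
  rw [bind_mapCells μ (fun y m R => (mapCells (F y R) m.snd).bind fun l =>
    PMF.pure (assembleRound m.fst l)) j]
  · congr 1; funext m R
    rw [← PMF.bind_bind]
    congr 1
    refine bind_mapCells μ (fun y => F y R) (j - R.size) (fun a b h => hF R a b fun h' => h ?_) _
    simp only [Data.size]
    omega
  · intro m R h y y'
    rw [mapCells_congr m.snd fun a b hab => hF R a b (fun h' => h ?_) y y']
    have := m.snd_size_le
    simp only [Data.size] at *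
    omega

/-- Every position is smaller than the size of the whole list of messages. -/
theorem roundsData_congr {F G : Data → Data → Data → PMF Data} {t : Data}
    (h : ∀ R a b, b.size + R.size < t.size → F R a b = G R a b) :
    roundsData F t = roundsData G t := by
  refine mapCells_congr t fun m R hm => ?_
  rw [mapCells_congr m.snd fun a b hab => h R a b ?_]
  have := m.snd_size_le
  simp only [Data.size] at *
  omega

/-- For fixed keys, neither the share nor the run of the environment involves `y`, so its sampling
can be postponed to the split at position `j`. -/
theorem bind_runHybrid {γ : Type} (μ : PMF γ) (n : ℕ) (env : Prog) (k N g hs : Data)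
    (F : γ → Data → Data → Data → PMF Data) (j : ℕ)
    (hF : ∀ R a b, b.size + R.size ≠ j → ∀ y y', F y R a b = F y' R a b) :
    (μ.bind fun y => runHybrid n env k N g hs (F y)) =
      runHybrid n env k N g hs fun R a b => μ.bind fun y => F y R a b := by
  unfold runHybrid
  rw [PMF.bind_comm μ]
  congr 1; funext l2
  rw [PMF.bind_comm μ]
  congr 1; funext e
  rw [← bind_roundsData μ F j hF, PMF.bind_bind]

/-- The treatment of an item in the hybrid games, without a challenge. -/
def stepNode (n i N g j : ℕ) (hs R a b : Data) : PMF Data :=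
  if a.fst.val < i ∨ (a.fst.val = i ∧ b.size + R.size < j) then idealNode N g
  else realNode N g (nth n hs a.fst.val) a.snd.val

theorem bind_hybridNode_real {n i N x : ℕ} (hN : 4 ≤ N) (g : Z2 N) (j : ℕ) {hs : Data}
    (hx : nth n hs i = (g ^ x).val) (R a b : Data) :
    ((sampleExp N).bind fun y =>
      hybridNode n i N g.val j (g ^ y).val (g ^ (x * y)).val hs R a b) =
      stepNode n i N g.val j hs R a b := by
  unfold hybridNode stepNode
  split_ifs with h1 h2
  · rw [PMF.bind_const]
  · rw [challengeNode_real hN, h2.1, hx]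
  · rw [PMF.bind_const]

/-- With a random challenge the split of `i` at position `j` is simulated too, which moves the
threshold to `j + 1`. -/
theorem bind_hybridNode_random {n i N : ℕ} (hN : 4 ≤ N) (hodd : Odd N) (g : Z2 N) (j : ℕ)
    (hs R a b : Data) :
    ((sampleExp N).bind fun y => (sampleElt N).bind fun Z =>
      hybridNode n i N g.val j (g ^ y).val Z.val hs R a b) =
      stepNode n i N g.val (j + 1) hs R a b := by
  unfold hybridNode stepNode
  split_ifs with h1 h2 h3 h4 h5
  · simp only [PMF.bind_const]
  · omega
  · rw [challengeNode_random hN hodd]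
  · omega
  · omega
  · simp only [PMF.bind_const]

/-! ### The hybrid games -/

/-- Replacing one of several independent samples by a fresh one. -/
theorem bind_iid_update {α β : Type} (μ : PMF α) : ∀ {n : ℕ} (i : Fin n) (Φ : (Fin n → α) → PMF β),
    (μ.bind fun x => (iid μ n).bind fun f => Φ (Function.update f i x)) = (iid μ n).bind Φ
  | 0, i, _ => i.elim0
  | n + 1, i, Φ => by
      simp only [iid, PMF.bind_bind, PMF.pure_bind]
      refine Fin.cases ?_ (fun i => ?_) i
      · simp only [Fin.update_cons_zero, PMF.bind_const]
      · rw [PMF.bind_comm μ μ]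
        congr 1; funext a
        rw [← bind_iid_update μ i fun f => Φ (Fin.cons a f)]
        simp only [Fin.cons_update]

/-- The public keys as data. -/
def keysData {n N : ℕ} (g : Z2 N) (sk : Fin n → ℕ) : Data :=
  .ofList (List.ofFn fun v => .num (g ^ sk v).val)

theorem nth_keysData {n N : ℕ} (g : Z2 N) (sk : Fin n → ℕ) (v : Fin n) :
    nth n (keysData g sk) v = (g ^ sk v).val := nth_ofFn (fun v => (g ^ sk v).val) v

theorem keysWith_eq {n N : ℕ} (hN : 4 ≤ N) (i : Fin n) (g : Z2 N) (x : ℕ) :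
    keysWith n i N g.val (.num (g ^ x).val) =
      (iid (sampleExp N) n).map fun sk => keysData g (Function.update sk i x) := by
  have h0 : 0 < N := by omega
  rw [keysWith, sampleExp_eq hN]
  congr 1; funext sk
  rw [keysData]
  congr 2; funext v
  by_cases hv : v = i
  · rw [if_pos (congrArg Fin.val hv), hv, Function.update_self]
  · rw [if_neg (fun h => hv (Fin.ext h)), Function.update_of_ne hv, val_pow_eq h0]

/-- The hybrid game for given keys. -/
def hybridGame (n : ℕ) (env : Prog) (k i j : ℕ) {N : ℕ} (g : Z2 N) (sk : Fin n → ℕ) : PMF Data :=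
  runHybrid n env (.unary k) (.num N) (.num g.val) (keysData g sk)
    (stepNode n i N g.val j (keysData g sk))

/-- The hybrid game. -/
def hybrid (n : ℕ) (gen : ℕ → PMF (ℕ × ℕ)) (env : Prog) (i j k : ℕ) : PMF Data :=
  (gen k).bind fun pq => (sampleG pq.1 pq.2).bind fun g =>
    (iid (sampleExp (pq.1 * pq.2)) n).bind fun sk => hybridGame n env k i j g sk

theorem Data.size_unary (k : ℕ) : (Data.unary k).size = 2 * k + 1 := by
  unfold Data.unary
  induction k with
  | zero => simp [Data.ofList, Data.size]
  | succ k ih =>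
      have : (Data.num 0).size = 1 := by simp [Data.size]
      simp only [List.replicate_succ, Data.ofList, Data.size, ih] at *
      omega

theorem reduction_ddhData (n i : ℕ) (Q : Polynomial ℕ) (env : Prog) (k N : ℕ) (g X Y Z : Z2 N) :
    reduction n i Q env (ddhData k N g X Y Z) =
      (unif (Finset.range (Q.eval (2 * k + 1)))).bind fun j =>
        (keysWith n i N g.val (.num X.val)).bind fun hs =>
          runHybrid n env (.unary k) (.num N) (.num g.val) hs
            (hybridNode n i N g.val j Y.val Z.val hs) := by
  rw [← Data.size_unary]
  rfl

/-- The reduction turns challenges into hybrid games. -/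
theorem bind_reduction {n N : ℕ} (hN : 4 ≤ N) (i : Fin n) (Q : Polynomial ℕ) (env : Prog) (k : ℕ)
    (g : Z2 N) (ν : ℕ → PMF (Z2 N × Z2 N)) (δ : ℕ)
    (hν : ∀ x j hs, nth n hs i = (g ^ x).val → ∀ R a b, ((ν x).bind fun p =>
      hybridNode n i N g.val j p.1.val p.2.val hs R a b) =
        stepNode n i N g.val (j + δ) hs R a b) :
    ((sampleExp N).bind fun x => (ν x).bind fun p =>
      reduction n i Q env (ddhData k N g (g ^ x) p.1 p.2)) =
    (unif (Finset.range (Q.eval (2 * k + 1)))).bind fun j =>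
      (iid (sampleExp N) n).bind fun sk => hybridGame n env k i (j + δ) g sk := by
  simp only [reduction_ddhData, keysWith_eq hN, PMF.bind_map, Function.comp_def]
  have h : ∀ x, ((ν x).bind fun p => (unif (Finset.range (Q.eval (2 * k + 1)))).bind fun j =>
      (iid (sampleExp N) n).bind fun sk =>
        runHybrid n env (.unary k) (.num N) (.num g.val) (keysData g (Function.update sk i x))
          (hybridNode n i N g.val j p.1.val p.2.val (keysData g (Function.update sk i x)))) =
      (unif (Finset.range (Q.eval (2 * k + 1)))).bind fun j =>
        (iid (sampleExp N) n).bind fun sk =>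
          hybridGame n env k i (j + δ) g (Function.update sk i x) := by
    intro x
    -- The key of `i` depends on `x`, which stays outside; the rest `p` of the challenge enters only
    -- at position `j` and is moved there.
    rw [PMF.bind_comm (ν x)]
    congr 1; funext j
    rw [PMF.bind_comm (ν x)]
    congr 1; funext sk
    rw [bind_runHybrid (ν x) n env _ _ _ _ (fun p => hybridNode n i N g.val j p.1.val p.2.val
      (keysData g (Function.update sk i x))) j]
    · rw [hybridGame]
      congr 1; funext R a b
      exact hν x j _ (by rw [nth_keysData, Function.update_self]) R a b
    · intro R a b hj p p'
      unfold hybridNode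
      simp only [hj, and_false, if_false]
  simp only [h]
  rw [PMF.bind_comm (sampleExp N)]
  congr 1; funext j
  -- Overwriting key `i` by an independent fresh exponent `x` leaves the joint distribution of the
  -- keys unchanged.
  exact bind_iid_update (sampleExp N) i fun sk => hybridGame n env k i (j + δ) g sk

theorem ddhReal_bind_reduction {n : ℕ} (gen : ℕ → PMF (ℕ × ℕ)) (env : Prog) (i : Fin n)
    (Q : Polynomial ℕ) {k : ℕ} (hgen : ∀ pq ∈ (gen k).support, 4 ≤ pq.1 * pq.2) :
    (ddhReal gen k).bind (reduction n i Q env) =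
      (unif (Finset.range (Q.eval (2 * k + 1)))).bind fun j => hybrid n gen env i j k := by
  unfold ddhReal hybrid
  rw [PMF.bind_comm (unif _), PMF.bind_bind]
  refine bind_congr_support _ fun pq hpq => ?_
  rw [PMF.bind_comm (unif _), PMF.bind_bind]
  congr 1; funext g
  have := bind_reduction (hgen pq hpq) i Q env k g
    (fun x => (sampleExp (pq.1 * pq.2)).map fun y => (g ^ y, g ^ (x * y))) 0
    (fun x j hs hx R a b => by
      simp only [PMF.bind_map, Function.comp_def]
      exact bind_hybridNode_real (hgen pq hpq) g j hx R a b)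
  simp only [PMF.bind_map, Function.comp_def] at this
  simpa only [PMF.bind_bind, PMF.pure_bind, Nat.add_zero] using this

theorem ddhRandom_bind_reduction {n : ℕ} (gen : ℕ → PMF (ℕ × ℕ)) (env : Prog) (i : Fin n)
    (Q : Polynomial ℕ) {k : ℕ}
    (hgen : ∀ pq ∈ (gen k).support, 4 ≤ pq.1 * pq.2 ∧ Odd (pq.1 * pq.2)) :
    (ddhRandom gen k).bind (reduction n i Q env) =
      (unif (Finset.range (Q.eval (2 * k + 1)))).bind fun j => hybrid n gen env i (j + 1) k := by
  unfold ddhRandom hybrid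
  rw [PMF.bind_comm (unif _), PMF.bind_bind]
  refine bind_congr_support _ fun pq hpq => ?_
  rw [PMF.bind_comm (unif _), PMF.bind_bind]
  congr 1; funext g
  have := bind_reduction (hgen pq hpq).1 i Q env k g
    (fun _ => (sampleExp (pq.1 * pq.2)).bind fun y => (sampleElt (pq.1 * pq.2)).map fun Z =>
      (g ^ y, Z)) 1
    (fun x j hs _ R a b => by
      simp only [PMF.bind_bind, PMF.bind_map, Function.comp_def]
      exact bind_hybridNode_random (hgen pq hpq).1 (hgen pq hpq).2 g j hs R a b)
  simp only [PMF.bind_bind, PMF.bind_map, Function.comp_def] at this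
  simpa only [PMF.bind_bind, PMF.pure_bind] using this

/-! ### Acceptance probabilities -/

theorem accepts_nonneg (D : Prog) (μ : PMF Data) : 0 ≤ accepts D μ := ENNReal.toReal_nonneg

theorem accepts_le_one (D : Prog) (μ : PMF Data) : accepts D μ ≤ 1 := by
  have h := (μ.bind D.out).coe_le_one (.num 1)
  exact ENNReal.toReal_le_of_le_ofReal zero_le_one (by simpa using h)

theorem accepts_bind {α : Type} (D : Prog) (μ : PMF α) (f : α → PMF Data) :
    accepts D (μ.bind f) = ∑' a, (μ a).toReal * accepts D (f a) := by
  rw [accepts, PMF.bind_bind, PMF.bind_apply, ENNReal.tsum_toReal_eq fun a =>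
    ENNReal.mul_ne_top (μ.apply_ne_top a) (PMF.apply_ne_top _ _)]
  simp only [ENNReal.toReal_mul, accepts]

theorem summable_mul_accepts {α : Type} (D : Prog) (μ : PMF α) (f : α → PMF Data) :
    Summable fun a => (μ a).toReal * accepts D (f a) :=
  Summable.of_nonneg_of_le
    (fun a => mul_nonneg ENNReal.toReal_nonneg (accepts_nonneg D _))
    (fun a => mul_le_of_le_one_right ENNReal.toReal_nonneg (accepts_le_one D _))
    (ENNReal.summable_toReal (by rw [μ.tsum_coe]; exact ENNReal.one_ne_top))

theorem abs_accepts_bind_sub_le {α : Type} (D : Prog) (μ : PMF α) {f g : α → PMF Data} {ε : ℝ}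
    (h : ∀ a ∈ μ.support, |accepts D (f a) - accepts D (g a)| ≤ ε) :
    |accepts D (μ.bind f) - accepts D (μ.bind g)| ≤ ε := by
  have hs : Summable fun a => (μ a).toReal :=
    ENNReal.summable_toReal (by rw [μ.tsum_coe]; exact ENNReal.one_ne_top)
  have h1 : ∑' a, (μ a).toReal = 1 := by
    rw [← ENNReal.tsum_toReal_eq μ.apply_ne_top, μ.tsum_coe, ENNReal.toReal_one]
  have hle : ∀ a, |(μ a).toReal * accepts D (f a) - (μ a).toReal * accepts D (g a)| ≤
      (μ a).toReal * ε := by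
    intro a
    rw [← mul_sub, abs_mul, abs_of_nonneg ENNReal.toReal_nonneg]
    by_cases ha : a ∈ μ.support
    · exact mul_le_mul_of_nonneg_left (h a ha) ENNReal.toReal_nonneg
    · rw [(PMF.apply_eq_zero_iff μ a).2 ha]
      simp
  have hsum := (summable_mul_accepts D μ f).sub (summable_mul_accepts D μ g)
  rw [accepts_bind, accepts_bind,
    ← (summable_mul_accepts D μ f).tsum_sub (summable_mul_accepts D μ g)]
  have h2 : ∑' a, (μ a).toReal * ε = ε := by rw [tsum_mul_right, h1, one_mul]
  rw [← h2, abs_le, ← tsum_neg]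
  exact ⟨(hs.mul_right ε).neg.tsum_le_tsum (fun a => (abs_le.1 (hle a)).1) hsum,
    hsum.tsum_le_tsum (fun a => (abs_le.1 (hle a)).2) (hs.mul_right ε)⟩

theorem accepts_bind_unif (D : Prog) {A : ℕ} (hA : 0 < A) (f : ℕ → PMF Data) :
    accepts D ((unif (Finset.range A)).bind f) =
      (∑ i ∈ Finset.range A, accepts D (f i)) / A := by
  rw [accepts_bind, unif, dif_pos (Finset.nonempty_range_iff.2 hA.ne'),
    tsum_eq_sum (s := Finset.range A), Finset.sum_div]
  · refine Finset.sum_congr rfl fun i hi => ?_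
    rw [PMF.uniformOfFinset_apply, if_pos hi, Finset.card_range, ENNReal.toReal_inv,
      ENNReal.toReal_natCast, inv_mul_eq_div]
  · intro i hi
    rw [PMF.uniformOfFinset_apply, if_neg hi, ENNReal.toReal_zero, zero_mul]

/-- If `S` and `T` sum the acceptance probabilities below `A` and from `A` to `B`, the difference is
`(S / A * (B - A) - T) / B`, and both terms of the numerator lie between `0` and `B - A`. -/
theorem abs_accepts_unif_sub_le (D : Prog) {A B : ℕ} (hA : 0 < A) (hAB : A ≤ B)
    (f : ℕ → PMF Data) :
    |accepts D ((unif (Finset.range A)).bind f) - accepts D ((unif (Finset.range B)).bind f)| ≤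
      ((B : ℝ) - A) / B := by
  have hA' : (0 : ℝ) < A := by exact_mod_cast hA
  have hAB' : (A : ℝ) ≤ B := by exact_mod_cast hAB
  have hB' : (0 : ℝ) < B := hA'.trans_le hAB'
  rw [accepts_bind_unif D hA, accepts_bind_unif D (hA.trans_le hAB),
    ← Finset.sum_range_add_sum_Ico _ hAB]
  set S := ∑ i ∈ Finset.range A, accepts D (f i)
  set T := ∑ i ∈ Finset.Ico A B, accepts D (f i)
  have hS0 : 0 ≤ S := Finset.sum_nonneg fun i _ => accepts_nonneg D _
  have hT0 : 0 ≤ T := Finset.sum_nonneg fun i _ => accepts_nonneg D _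
  have hS1 : S ≤ A := by
    have := Finset.sum_le_card_nsmul (Finset.range A) (fun i => accepts D (f i)) 1
      fun i _ => accepts_le_one D _
    simpa using this
  have hT1 : T ≤ (B : ℝ) - A := by
    have := Finset.sum_le_card_nsmul (Finset.Ico A B) (fun i => accepts D (f i)) 1
      fun i _ => accepts_le_one D _
    simpa [Nat.cast_sub hAB] using this
  have hSA : S / A ≤ 1 := (div_le_one hA').2 hS1
  have hSA0 : 0 ≤ S / A := div_nonneg hS0 hA'.le
  have key : S / A - (S + T) / B = (S / A * ((B : ℝ) - A) - T) / B := by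
    field_simp
    ring
  rw [key, abs_div, abs_of_pos hB']
  refine div_le_div_of_nonneg_right ?_ hB'.le
  rw [abs_le]
  constructor <;> nlinarith

/-- A distinguisher after `K` is itself a distinguisher once `K` is made part of it. -/
theorem CompIndist.bind {X Y : ℕ → PMF Data} (h : CompIndist X Y) {K : Data → PMF Data}
    (hK : Feasible K) : CompIndist (fun k => (X k).bind K) (fun k => (Y k).bind K) := by
  intro D hD
  obtain ⟨P, hP, hout⟩ := Feasible.comp hK hD.feasible
  have hacc : ∀ μ : PMF Data, accepts P μ = accepts D (μ.bind K) := fun μ => by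
    rw [accepts, accepts, PMF.bind_bind, funext hout]
  simpa only [hacc] using h P hP

/-! ### Sizes of the keys -/

theorem two_pow_size_le {p : ℕ} (hp : 0 < p) : 2 ^ Nat.size p ≤ 2 * p := by
  have h : 0 < Nat.size p := Nat.size_pos.2 hp
  have h1 : 2 ^ (Nat.size p - 1) ≤ p := Nat.lt_size.1 (by omega)
  obtain ⟨m, hm⟩ : ∃ m, Nat.size p = m + 1 := ⟨Nat.size p - 1, by omega⟩
  rw [hm, Nat.add_sub_cancel] at h1
  rw [hm, pow_succ]
  omega

/-- The arithmetic facts about admissible primes that the proof uses. -/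
theorem ValidPrimes.exists_eq {k p q : ℕ} (h : ValidPrimes k p q) :
    ∃ a b, p = 2 * a + 1 ∧ q = 2 * b + 1 ∧ 0 < a ∧ 0 < b ∧
      Nat.lcm (p - 1) (q - 1) = 2 * (a * b) ∧ 2 ^ k ≤ 4 * a + 2 ∧ 2 ^ k ≤ 4 * b + 2 := by
  have hp := h.prime_p.two_le
  have hq := h.prime_q.two_le
  have ha := h.odd_p.pos
  have hb := h.odd_q.pos
  have hp1 : p ≠ 2 := by rintro rfl; simp at ha
  have hq1 : q ≠ 2 := by rintro rfl; simp at hb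
  have hp2 := h.prime_p.odd_of_ne_two hp1
  have hq2 := h.prime_q.odd_of_ne_two hq1
  obtain ⟨a, rfl⟩ := hp2
  obtain ⟨b, rfl⟩ := hq2
  have e1 : (2 * a + 1 - 1) / 2 = a := by omega
  have e2 : (2 * b + 1 - 1) / 2 = b := by omega
  have hc := h.coprime
  rw [e1] at ha
  rw [e2] at hb
  rw [e1, e2] at hc
  have s1 := two_pow_size_le h.prime_p.pos
  have s2 := two_pow_size_le h.prime_q.pos
  rw [h.size_p] at s1
  rw [h.size_q] at s2
  refine ⟨a, b, rfl, rfl, ha, hb, ?_, by omega, by omega⟩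
  rw [Nat.add_sub_cancel, Nat.add_sub_cancel, Nat.lcm_mul_left, hc.lcm_eq_mul]

theorem ValidPrimes.four_le {k p q : ℕ} (h : ValidPrimes k p q) : 4 ≤ p * q := by
  obtain ⟨a, b, rfl, rfl, ha, hb, -⟩ := h.exists_eq
  nlinarith

theorem ValidPrimes.odd_mul {k p q : ℕ} (h : ValidPrimes k p q) : Odd (p * q) := by
  obtain ⟨a, b, rfl, rfl, -⟩ := h.exists_eq
  exact (odd_two_mul_add_one a).mul (odd_two_mul_add_one b)

theorem ValidPrimes.mul_lt {k p q : ℕ} (h : ValidPrimes k p q) : p * q < 2 ^ (2 * k) := by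
  have h1 := Nat.lt_size_self p
  have h2 := Nat.lt_size_self q
  rw [h.size_p] at h1
  rw [h.size_q] at h2
  rw [two_mul, pow_add]
  exact Nat.mul_lt_mul'' h1 h2

/-- The share of the computation service provider is statistically close to a value that can be
sampled without knowing the factorization. -/
theorem abs_accepts_sampleShares_sub_le (D : Prog) {k p q : ℕ} (h : ValidPrimes k p q)
    (f : ℕ → PMF Data) :
    |accepts D ((sampleShares p q).bind fun l => f l.2) -
      accepts D ((unif (Finset.range (p * q / 2 * (p * q * (p * q))))).bind f)| ≤
        8 * (1 / 2) ^ k := by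
  -- Only the second share is used, and it is uniform below `λ N²`.
  have h1 : ((sampleShares p q).bind fun l => f l.2) =
      (unif (Finset.range (Nat.lcm (p - 1) (q - 1) * (p * q) ^ 2))).bind f := by
    simp only [sampleShares, PMF.bind_map, Function.comp_def]
  rw [h1]
  obtain ⟨a, b, hp, hq, ha, hb, hl, ha2, hb2⟩ := h.exists_eq
  have hN : 0 < p * q := Nat.mul_pos h.prime_p.pos h.prime_q.pos
  have hN2 : p * q / 2 = 2 * (a * b) + a + b := by
    have : p * q = 2 * (2 * (a * b) + a + b) + 1 := by rw [hp, hq]; ring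
    omega
  rw [hl, hN2, sq]
  set M := p * q * (p * q) with hM
  have hM0 : 0 < M := Nat.mul_pos hN hN
  have hab : 0 < a * b := Nat.mul_pos ha hb
  refine (abs_accepts_unif_sub_le D (Nat.mul_pos (by omega) hM0)
    (Nat.mul_le_mul_right M (by omega)) f).trans ?_
  have hM' : (0 : ℝ) < M := by exact_mod_cast hM0
  have ha' : (0 : ℝ) < a := by exact_mod_cast ha
  have hb' : (0 : ℝ) < b := by exact_mod_cast hb
  have ha3 : (2 : ℝ) ^ k ≤ 4 * a + 2 := by exact_mod_cast ha2
  have hb3 : (2 : ℝ) ^ k ≤ 4 * b + 2 := by exact_mod_cast hb2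
  have hk : (0 : ℝ) < 2 ^ k := by positivity
  have hpos : (0 : ℝ) < 2 * (a * b) + a + b := by positivity
  push_cast
  have e : ((2 * ((a : ℝ) * b) + a + b) * M - 2 * (a * b) * M) / ((2 * (a * b) + a + b) * M) =
      (a + b) / (2 * (a * b) + a + b) := by
    field_simp
    ring
  rw [e, one_div, inv_pow, ← div_eq_mul_inv, div_le_div_iff₀ hpos hk]
  -- The claim is `(a + b) 2 ^ k ≤ 8 (2 a b + a + b)`. Bounding `2 ^ k` by `4 b + 2` next to `a` and
  -- by `4 a + 2` next to `b` gives `8 a b + 2 a + 2 b` on the left.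
  nlinarith

theorem Data.size_num_le {x m : ℕ} (h : x < 2 ^ m) : (Data.num x).size ≤ m + 1 := by
  simp only [Data.size]
  have := Nat.size_le.2 h
  omega

theorem Data.size_ofList_le {l : List Data} {s : ℕ} (h : ∀ a ∈ l, a.size ≤ s) :
    (Data.ofList l).size ≤ l.length * (s + 1) + 1 := by
  induction l with
  | nil => simp [Data.ofList, Data.size]
  | cons a l ih =>
      have h1 := h a (by simp)
      have h2 := ih fun b hb => h b (by simp [hb])
      simp only [Data.ofList, Data.size, List.length_cons]
      nlinarith

/-- All numbers involved are below `2 ^ (6 * k)`, since `N ^ 3` is. Adding up gives `20 k + 11 + n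
(6 k + 2)`, linear in the size `2 * k + 1` of the unary security parameter. -/
theorem ccLocal_size_le {n k N : ℕ} (hN0 : 0 < N) (hN : N < 2 ^ (2 * k)) (g : Z2 N)
    (h : Fin n → Z2 N) {l2 : ℕ} (hl : l2 < N / 2 * (N * N)) :
    (ccLocal k N g h l2).size ≤ (3 * n + 11) * (2 * k + 1) := by
  have : NeZero (N ^ 2) := ⟨pow_ne_zero 2 hN0.ne'⟩
  have e6 : 2 ^ (6 * k) = 2 ^ (2 * k) * (2 ^ (2 * k) * 2 ^ (2 * k)) := by
    rw [← pow_add, ← pow_add]; congr 1; ring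
  have h3 : N * (N * N) < 2 ^ (6 * k) := by
    rw [e6]
    exact Nat.mul_lt_mul'' hN (Nat.mul_lt_mul'' hN hN)
  have hz : ∀ z : Z2 N, (Data.num z.val).size ≤ 6 * k + 1 := fun z =>
    Data.size_num_le <| (ZMod.val_lt z).trans <| lt_of_le_of_lt (by nlinarith) h3
  have s1 : (Data.num N).size ≤ 6 * k + 1 := Data.size_num_le <| by nlinarith
  have s2 := hz g
  have s3 : (Data.ofList (List.ofFn fun i => .num (h i).val)).size ≤ n * (6 * k + 1 + 1) + 1 := by
    have := Data.size_ofList_le (l := List.ofFn fun i => .num (h i).val) (s := 6 * k + 1) (by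
      intro a ha
      obtain ⟨i, rfl⟩ := (List.mem_ofFn' _ _).1 ha
      exact hz _)
    simpa using this
  have s4 : (Data.num l2).size ≤ 6 * k + 1 := Data.size_num_le <| by
    have := Nat.mul_le_mul_right (N * N) (Nat.div_le_self N 2)
    omega
  have s5 : (Data.num 0).size = 1 := by simp [Data.size]
  have s6 := Data.size_unary k
  simp only [ccLocal, Data.ofList, Data.size] at *
  nlinarith

/-! ### From the real to the ideal view -/

/-- Once the view has the form of a hybrid, the only remaining difference is the range of the share.
-/
theorem experiment_close (n : ℕ) (gen : ℕ → PMF (ℕ × ℕ)) (env D : Prog)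
    (view : {N : ℕ} → (g : Z2 N) → (h : Fin n → Z2 N) → (loc : Data) → RevocInput n → PMF Data)
    (i k : ℕ) (hgen : ∀ pq ∈ (gen k).support, ValidPrimes k pq.1 pq.2)
    (hview : ∀ (N : ℕ) (g : Z2 N) (sk : Fin n → ℕ) (l2 : ℕ) (d : Data), 4 ≤ N →
      view g (fun v => g ^ sk v) (ccLocal k N g (fun v => g ^ sk v) l2) (RevocInput.ofData n d) =
        roundsData (stepNode n i N g.val 0 (keysData g sk)) (messagesData n d)) :
    |accepts D (experiment n gen env view k) - accepts D (hybrid n gen env i 0 k)| ≤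
      8 * (1 / 2) ^ k := by
  refine abs_accepts_bind_sub_le D _ fun pq hpq => ?_
  refine abs_accepts_bind_sub_le D _ fun g _ => ?_
  refine abs_accepts_bind_sub_le D _ fun sk _ => ?_
  have hv := hgen pq hpq
  simp only [hview _ _ _ _ _ hv.four_le]
  exact abs_accepts_sampleShares_sub_le D hv fun l2 =>
    (env.out (ccLocal k (pq.1 * pq.2) g (fun v => g ^ sk v) l2)).bind fun e =>
      (roundsData (stepNode n i (pq.1 * pq.2) g.val 0 (keysData g sk))
        (messagesData n e.snd)).bind fun t =>
          PMF.pure (.pair (ccLocal k (pq.1 * pq.2) g (fun v => g ^ sk v) l2) (.pair e t))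

theorem realView_close (n : ℕ) (gen : ℕ → PMF (ℕ × ℕ)) (env D : Prog) (k : ℕ)
    (hgen : ∀ pq ∈ (gen k).support, ValidPrimes k pq.1 pq.2) :
    |accepts D (realView n gen env k) - accepts D (hybrid n gen env 0 0 k)| ≤
      8 * (1 / 2) ^ k := by
  refine experiment_close n gen env D _ 0 k hgen fun N g sk l2 d hN => ?_
  have h0 : 0 < N := by omega
  rw [sampleList_ccRound_eq_roundsData g (fun v => g ^ sk v) _
    (fun a => realNode N g.val (nth n (keysData g sk) a.fst.val) a.snd.val)]
  · refine roundsData_congr fun R a b _ => ?_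
    simp only [stepNode, Nat.not_lt_zero, and_false, or_false, if_false]
  · intro a
    simp only [nodeData, Data.fst, Data.snd, Data.val, nth_keysData, realNode_val hN,
      refreshDist_val h0]

/-- The items enter only through `F (f a)`; where this is constant, the result depends on the
requests and the lengths alone, which is what the simulator is given. -/
theorem roundsData_messages {n : ℕ} (F : Data → PMF Data) (ms : List (Message (Fin n × ℕ)))
    (f : Fin n × ℕ → Data) :
    roundsData (fun _ a _ => F a) (.ofList (ms.map fun m =>
      .pair m.request (.ofList (m.splits.map f)))) =
    (sampleList (fun m => ((sampleList (fun a => F (f a)) m.splits).map Data.ofList).bind fun l =>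
      PMF.pure (assembleRound m.request l)) ms).map Data.ofList := by
  rw [roundsData, mapCells_ofList (fun m => (mapCells (fun a _ => F a) m.snd).bind fun l =>
    PMF.pure (assembleRound m.fst l)) fun m : Message (Fin n × ℕ) =>
      .pair m.request (.ofList (m.splits.map f))]
  simp only [Data.fst, Data.snd, mapCells_ofList]

theorem idealView_close (n : ℕ) (gen : ℕ → PMF (ℕ × ℕ)) (env sim D : Prog)
    (hsim : ∀ x, sim.out x = simDist x) (k : ℕ)
    (hgen : ∀ pq ∈ (gen k).support, ValidPrimes k pq.1 pq.2) :
    |accepts D (idealView n gen env sim k) - accepts D (hybrid n gen env n 0 k)| ≤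
      8 * (1 / 2) ^ k := by
  refine experiment_close n gen env D _ n k hgen fun N g sk l2 d hN => ?_
  -- `stepNode` acts on arbitrary data, so the second branch is dropped only on items `nodeData a`,
  -- whose label is an element of `Fin n`.
  let G : Data → PMF Data := fun a => if a.fst.val < n then idealNode N g.val
    else realNode N g.val (nth n (keysData g sk) a.fst.val) a.snd.val
  have h1 : roundsData (stepNode n n N g.val 0 (keysData g sk)) (messagesData n d) =
      roundsData (fun _ a _ => G a) (messagesData n d) :=
    roundsData_congr fun R a b _ => by
      simp only [stepNode, Nat.not_lt_zero, and_false, or_false, G]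
  have h2 := roundsData_messages G (plainMessages (RevocInput.ofData n d)) nodeData
  have h3 := roundsData_messages (fun _ => idealNode N g.val)
    (plainMessages (RevocInput.ofData n d)) fun _ => .num 0
  have h4 : ∀ a : Fin n × ℕ, G (nodeData a) = idealNode N g.val := fun a =>
    if_pos a.1.2
  rw [hsim, simDist, leakage_eq, h1]
  simp only [h4] at h2
  refine Eq.trans ?_ (h3.trans h2.symm)
  simp only [List.map_const']
  rfl

/-- All positions are below `Q`, so every split of `i` is simulated, and the condition becomes
"provider before `i + 1`". -/
theorem hybridGame_succ {n : ℕ} {env : Prog} {k i Q N : ℕ} (hN : 4 ≤ N) {g : Z2 N}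
    {sk : Fin n → ℕ} (hQ : ∀ l2 < N / 2 * (N * N),
      ∀ e ∈ (env.out (ccLocal k N g (fun v => g ^ sk v) l2)).support,
        (messagesData n e.snd).size ≤ Q) :
    hybridGame n env k i Q g sk = hybridGame n env k (i + 1) 0 g sk := by
  unfold hybridGame runHybrid
  have h0 : 0 < N / 2 * (N * N) := Nat.mul_pos (by omega) (Nat.mul_pos (by omega) (by omega))
  refine bind_congr_support _ fun l2 hl2 => ?_
  refine bind_congr_support _ fun e he => ?_
  congr 1
  refine roundsData_congr fun R a b hab => ?_
  have hab' := hab.trans_le (hQ l2 (lt_of_mem_support_unif h0 hl2) e he)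
  unfold stepNode
  have : (a.fst.val < i ∨ a.fst.val = i ∧ b.size + R.size < Q) ↔
      (a.fst.val < i + 1 ∨ a.fst.val = i + 1 ∧ b.size + R.size < 0) := by omega
  simp only [this]

/-- A polynomial bound on the size of the messages in all games. -/
theorem exists_position_bound (n : ℕ) {env : Prog} (henv : env.PPT) :
    ∃ Q : Polynomial ℕ, (∀ s, 0 < Q.eval s) ∧ ∀ (gen : ℕ → PMF (ℕ × ℕ)) (i k : ℕ),
      (∀ pq ∈ (gen k).support, ValidPrimes k pq.1 pq.2) →
      hybrid n gen env i (Q.eval (2 * k + 1)) k = hybrid n gen env (i + 1) 0 k := by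
  obtain ⟨be, hbe⟩ := henv.feasible.exists_size_le
  obtain ⟨bm, hbm⟩ := (FeasibleFun.plainMessages n).exists_size_le
  -- The bounds are chained: local data, output of the environment, messages. The `+ 1` keeps the
  -- range of guesses nonempty.
  refine ⟨(bm.comp be).comp (Polynomial.C (3 * n + 11) * Polynomial.X) + 1, fun s => by simp,
    fun gen i k hgen => ?_⟩
  refine bind_congr_support _ fun pq hpq => ?_
  have hv := hgen pq hpq
  congr 1; funext g
  congr 1; funext sk
  have h0 : 0 < pq.1 * pq.2 := by have := hv.four_le; omega
  refine hybridGame_succ hv.four_le fun l2 hl2 e he => ?_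
  have h1 := ccLocal_size_le h0 hv.mul_lt g (fun v => g ^ sk v) hl2
  have h2 := (hbe _ e he).trans (natPoly_mono be h1)
  have h3 := (hbm e.snd).trans (natPoly_mono bm (e.snd_size_le.trans h2))
  simp only [Polynomial.eval_add, Polynomial.eval_comp, Polynomial.eval_mul, Polynomial.eval_C,
    Polynomial.eval_X, Polynomial.eval_one]
  exact h3.trans (Nat.le_succ _)

/-- The sum over the guesses `j` telescopes; the factor is the loss from guessing the position. -/
theorem hybrid_sub_eq {n : ℕ} (gen : ℕ → PMF (ℕ × ℕ)) (env D : Prog) (i : Fin n)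
    {Q : Polynomial ℕ} (hQ : ∀ s, 0 < Q.eval s) {k : ℕ}
    (hgen : ∀ pq ∈ (gen k).support, ValidPrimes k pq.1 pq.2) :
    accepts D (hybrid n gen env i 0 k) - accepts D (hybrid n gen env i (Q.eval (2 * k + 1)) k) =
      ((Q.eval (2 * k + 1) : ℕ) : ℝ) * (accepts D ((ddhReal gen k).bind (reduction n i Q env)) -
        accepts D ((ddhRandom gen k).bind (reduction n i Q env))) := by
  have h0 : ((Q.eval (2 * k + 1) : ℕ) : ℝ) ≠ 0 := by exact_mod_cast (hQ _).ne'
  rw [ddhReal_bind_reduction gen env i Q fun pq hpq => (hgen pq hpq).four_le,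
    ddhRandom_bind_reduction gen env i Q fun pq hpq =>
      ⟨(hgen pq hpq).four_le, (hgen pq hpq).odd_mul⟩,
    accepts_bind_unif D (hQ _), accepts_bind_unif D (hQ _), ← sub_div, ← Finset.sum_sub_distrib,
    Finset.sum_range_sub' fun j => accepts D (hybrid n gen env i j k)]
  field_simp

/-! ### Negligible functions -/

theorem negligible_two_pow : Negligible fun k => (1 / 2 : ℝ) ^ k := fun m =>
  tendsto_pow_const_mul_const_pow_of_lt_one m (by norm_num) (by norm_num)

theorem Negligible.natPoly_mul {f : ℕ → ℝ} (hf : Negligible f) (Q : Polynomial ℕ) :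
    Negligible fun k => ((Q.eval k : ℕ) : ℝ) * f k := by
  refine (Asymptotics.SuperpolynomialDecay.polynomial_mul hf
    (Q.map (Nat.castRingHom ℝ))).congr fun k => ?_
  rw [Polynomial.eval_natCast_map]
  rfl

theorem Negligible.sum {ι : Type} (s : Finset ι) {f : ι → ℕ → ℝ} (h : ∀ i ∈ s, Negligible (f i)) :
    Negligible fun k => ∑ i ∈ s, f i k := by
  classical
  induction s using Finset.induction_on with
  | empty =>
      simp only [Finset.sum_empty]
      exact Asymptotics.superpolynomialDecay_zero _ _
  | insert a s ha ih =>
      simp only [Finset.sum_insert ha]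
      exact (h a (by simp)).add (ih fun i hi => h i (by simp [hi]))

end RevFRF

end

/-! ### Combining the hybrids -/

theorem mainTheorem7 (n : ℕ) (gen : ℕ → PMF (ℕ × ℕ)) (hgen : RevFRF.ValidGen gen)
    (hddh : RevFRF.DDH gen) :
    ∃ sim : RevFRF.Prog, sim.PPT ∧
      ∀ env : RevFRF.Prog, env.PPT →
        RevFRF.CompIndist (RevFRF.realView n gen env) (RevFRF.idealView n gen env sim) := by
  open RevFRF in
  obtain ⟨sim, hsim, hout⟩ := feasible_simDist
  refine ⟨sim, hsim, fun env henv D hD => ?_⟩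
  obtain ⟨Q, hQ0, hQ⟩ := exists_position_bound n henv
  let adv : Fin n → ℕ → ℝ := fun i k => |accepts D ((ddhReal gen k).bind (reduction n i Q env)) -
    accepts D ((ddhRandom gen k).bind (reduction n i Q env))|
  have hadv : ∀ i, Negligible (adv i) := fun i =>
    CompIndist.bind hddh (feasible_reduction n i Q henv) D hD
  -- The share is replaced at both ends of the chain of hybrids, at a cost of `8 / 2 ^ k` each; the
  -- sum has a fixed number `n` of terms.
  have hbound : Negligible fun k => 16 * (1 / 2 : ℝ) ^ k +
      ∑ i, ((Q.eval (2 * k + 1) : ℕ) : ℝ) * adv i k := by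
    refine (negligible_two_pow.const_mul 16).add (Negligible.sum _ fun i _ => ?_)
    have := (hadv i).natPoly_mul (Q.comp (2 * Polynomial.X + 1))
    simpa [Polynomial.eval_comp] using this
  refine hbound.trans_eventually_abs_le ?_
  -- Key generation is admissible only for large `k`, which suffices for negligibility.
  filter_upwards [hgen] with k hk
  have h1 := realView_close n gen env D k hk
  have h2 := idealView_close n gen env sim D hout k hk
  have h3 : |accepts D (hybrid n gen env 0 0 k) - accepts D (hybrid n gen env n 0 k)| ≤
      ∑ i, ((Q.eval (2 * k + 1) : ℕ) : ℝ) * adv i k := by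
    -- Telescoping over the participants; each step runs from `hybrid i 0` to `hybrid (i + 1) 0`,
    -- which equals `hybrid i Q`.
    rw [← Finset.sum_range_sub' (fun i => accepts D (hybrid n gen env i 0 k)),
      Finset.sum_range fun i => accepts D (hybrid n gen env i 0 k) -
        accepts D (hybrid n gen env (i + 1) 0 k)]
    refine (Finset.abs_sum_le_sum_abs _ _).trans (Finset.sum_le_sum fun i _ => ?_)
    rw [← hQ gen i k hk, hybrid_sub_eq gen env D i hQ0 hk, abs_mul, Nat.abs_cast]
  simp only [Function.comp_apply, abs_abs]
  refine le_trans ?_ (le_abs_self _)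
  rw [abs_le] at *
  constructor <;> linarith [h1.1, h1.2, h2.1, h2.2, h3.1, h3.2]
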